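/- Let $\mathbb{N}=\{1,2,\ldots\}$ and, for $n\in\mathbb{N}$, let $X_n=\{1,\ldots,n\}\times\mathbb{N}$; the sets $\{i\}\times\mathbb{N}$ are its rays. Permutations act on the right. The Houghton group $H_n\le\mathrm{Sym}(X_n)$ consists of the permutations $g$ such that for every $i$ there is an integer $t_i(g)$ with $(i,m)g=(i,m+t_i(g))$ for all sufficiently large $m$. Let $S_n$ act on $X_n$ by permuting the rays, $(i,m)\sigma=(i\sigma,m)$; it normalises $H_n$, and $H_n\rtimes S_n$ denotes the resulting subgroup of $\mathrm{Sym}(X_n)$. Let $\mathrm{FSym}(X)$ be the group of permutations of $X$ with finite support and $\mathrm{FAlt}(X)$ its subgroup of even permutations. For $2\le i\le n$ let $g_i\in H_n$ be given by $(1,m)g_i=(1,m+1)$, $(i,1)g_i=(1,1)$, $(i,m)g_i=(i,m-1)$ for $m>1$, and $(j,m)g_i=(j,m)$ for $j\ne 1,i$. For $p\in\mathbb{N}$ put $U_p=\langle \mathrm{FAlt}(X_n),\,g_2^p,\ldots,g_n^p\rangle$. Let $n\ge 2$ and let $U$ be a subgroup of finite index in $H_n$. (1) There is an $m\in\mathbb{N}$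 such that $U_m\le U$, $N_{\mathrm{Sym}(X_n)}(U)\le N_{\mathrm{Sym}(X_n)}(U_m)$, and $U_m$ is characteristic in $U$. (2) For every $i$ some $u\in U$ has $t_i(u)>0$, so $T_i=\min\{t_i(u)\mid u\in U,\ t_i(u)>0\}$ is defined. Let $T=T_1+\cdots+T_n$, let $\phi\colon X_n\to X_T$ be the bijection which, for $1\le i\le n$ and $1\le d\le T_i$, sends the points $(i,d),(i,d+T_i),(i,d+2T_i),\ldots$ in this order to the points of the ray with number $T_1+\cdots+T_{i-1}+d$, and let $\hat\phi\colon\mathrm{Sym}(X_n)\to\mathrm{Sym}(X_T)$ be the isomorphism induced by $\phi$. Then \[(N_{\mathrm{Sym}(X_n)}(U))\hat\phi\le H_T\rtimes S_T .\] If $n=2$ or $\mathrm{FSym}(X_n)\le U$, then moreover $H_T\le (N_{\mathrm{Sym}(X_n)}(U))\hat\phi$. For every $U$, the group $(N_{\mathrm{Sym}(X_n)}(U))\hat\phi$ contains all $h\in H_T$ for which $t_1(h),\ldots,t_T(h)$ are all even. -/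

import Mathlib

namespace Houghton

/-- The set `X_n`: `n` disjoint rays, each a copy of the natural numbers. Rays and points are
numbered from `0`, so the `m`-th point of the `i`-th ray is `(i - 1, m - 1)`. -/
abbrev X (n : ℕ) : Type := Fin n × ℕ

/-- Far out on the `i`-th ray, `g` is the translation by `t`: that is, `t = t_i(g)`. -/
def EventualTranslation {n : ℕ} (g : Equiv.Perm (X n)) (i : Fin n) (t : ℤ) : Prop :=
  ∃ z : ℕ, ∀ m : ℕ, z ≤ m → (g (i, m)).1 = i ∧ ((g (i, m)).2 : ℤ) = m + t

theorem EventualTranslation.one {n : ℕ} (i : Fin n) :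
    EventualTranslation (1 : Equiv.Perm (X n)) i 0 :=
  ⟨0, fun m _ => by simp⟩

theorem EventualTranslation.mul {n : ℕ} {g h : Equiv.Perm (X n)} {i : Fin n} {s t : ℤ}
    (hg : EventualTranslation g i s) (hh : EventualTranslation h i t) :
    EventualTranslation (g * h) i (s + t) := by
  obtain ⟨z, hz⟩ := hg
  obtain ⟨w, hw⟩ := hh
  refine ⟨w + z + t.natAbs, fun m hm => ?_⟩
  obtain ⟨h1, h2⟩ := hw m (by omega)
  have e : h (i, m) = (i, (h (i, m)).2) := Prod.ext h1 rfl
  obtain ⟨h3, h4⟩ := hz (h (i, m)).2 (by omega)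
  rw [Equiv.Perm.mul_apply, e]
  exact ⟨h3, by omega⟩

theorem EventualTranslation.inv {n : ℕ} {g : Equiv.Perm (X n)} {i : Fin n} {t : ℤ}
    (hg : EventualTranslation g i t) : EventualTranslation g⁻¹ i (-t) := by
  obtain ⟨z, hz⟩ := hg
  refine ⟨z + t.natAbs, fun m hm => ?_⟩
  obtain ⟨h1, h2⟩ := hz (m - t).toNat (by omega)
  have e : g⁻¹ (i, m) = (i, (m - t).toNat) := by
    rw [Equiv.Perm.inv_eq_iff_eq]
    refine Prod.ext h1.symm ?_
    have h3 : ((g (i, (m - t).toNat)).2 : ℤ) = m := by omega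
    exact_mod_cast h3.symm
  rw [e]
  refine ⟨rfl, ?_⟩
  simp only
  omega

/-- The Houghton group `H_n`: the permutations of `X_n` that are eventually a translation on
each ray. -/
def H (n : ℕ) : Subgroup (Equiv.Perm (X n)) where
  carrier := {g | ∀ i, ∃ t : ℤ, EventualTranslation g i t}
  one_mem' i := ⟨0, .one i⟩
  mul_mem' hg hh i :=
    let ⟨s, hs⟩ := hg i
    let ⟨t, ht⟩ := hh i
    ⟨s + t, hs.mul ht⟩
  inv_mem' hg i :=
    let ⟨t, ht⟩ := hg i
    ⟨-t, ht.inv⟩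

/-- The finitary symmetric group `FSym(α)`: the permutations of finite support. -/
def FSym (α : Type*) : Subgroup (Equiv.Perm α) where
  carrier := {g | {x | g x ≠ x}.Finite}
  one_mem' := by simp
  mul_mem' {g h} hg hh := by
    refine (hg.union hh).subset fun x hx => ?_
    by_contra hc
    simp only [Set.mem_union, Set.mem_ofPred_eq, not_or, not_not] at hc
    exact hx (by rw [Equiv.Perm.mul_apply, hc.2, hc.1])
  inv_mem' {g} hg := by
    refine Set.Finite.subset hg fun x hx hc => hx ?_
    rw [Equiv.Perm.inv_eq_iff_eq, hc]

open scoped Classical in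
/-- The finitary alternating group `FAlt(α)`: the even permutations of finite support, that is,
the products of an even number of transpositions. -/
def FAlt (α : Type*) : Subgroup (Equiv.Perm α) where
  carrier := {g | ∃ l : List (Equiv.Perm α), (∀ τ ∈ l, τ.IsSwap) ∧ Even l.length ∧ l.prod = g}
  one_mem' := ⟨[], by simp⟩
  mul_mem' := by
    rintro _ _ ⟨l, hl, el, rfl⟩ ⟨k, hk, ek, rfl⟩
    refine ⟨l ++ k, fun τ hτ => ?_, ?_, List.prod_append⟩
    · exact (List.mem_append.1 hτ).elim (hl τ) (hk τ)
    · rw [List.length_append]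
      exact el.add ek
  inv_mem' := by
    rintro _ ⟨l, hl, el, rfl⟩
    refine ⟨(l.map fun τ => τ⁻¹).reverse, fun τ hτ => ?_, by simpa using el,
      (List.prod_inv_reverse l).symm⟩
    simp only [List.mem_reverse, List.mem_map] at hτ
    obtain ⟨σ, hσ, rfl⟩ := hτ
    obtain ⟨x, y, hxy, rfl⟩ := hl σ hσ
    exact ⟨x, y, hxy, Equiv.swap_inv x y⟩

/-- The underlying map of `shift`. -/
def shiftFun {n : ℕ} (a b : Fin n) (x : X n) : X n :=
  if x.1 = a then (a, x.2 + 1)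
  else if x.1 = b then (if x.2 = 0 then (a, 0) else (b, x.2 - 1))
  else x

theorem shiftFun_shiftFun {n : ℕ} {a b : Fin n} (h : a ≠ b) (x : X n) :
    shiftFun b a (shiftFun a b x) = x := by
  obtain ⟨j, m⟩ := x
  unfold shiftFun
  by_cases h1 : j = a
  · subst h1
    simp [h]
  · by_cases h2 : j = b
    · subst h2
      by_cases h3 : m = 0
      · simp [h1, h3, h]
      · simp [h1, h3]
        omega
    · simp [h1, h2]

/-- For distinct rays `a` and `b`: translate the ray `a` by `1`, translate the ray `b` by `-1`,
sending its first point to the first point of `a`, and fix all the other rays pointwise. -/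
def shift {n : ℕ} (a b : Fin n) (h : a ≠ b) : Equiv.Perm (X n) where
  toFun := shiftFun a b
  invFun := shiftFun b a
  left_inv := shiftFun_shiftFun h
  right_inv := shiftFun_shiftFun h.symm

/-- The subgroup `U_p` of `H_n`, generated by `FAlt(X_n)` and the `p`-th powers of the standard
elements `g_i`, where `i` runs through the rays other than the first one. -/
def U (n : ℕ) [NeZero n] (p : ℕ) : Subgroup (Equiv.Perm (X n)) :=
  Subgroup.closure
    ((FAlt (X n) : Set (Equiv.Perm (X n))) ∪ {g | ∃ (i : Fin n) (h : 0 ≠ i), g = shift 0 i h ^ p})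

/-- The isometric permutation `(i, m) ↦ (σ i, m)` of the rays of `X_n` induced by `σ`. -/
def rayPerm (n : ℕ) : Equiv.Perm (Fin n) →* Equiv.Perm (X n) where
  toFun σ := Equiv.prodCongr σ (Equiv.refl ℕ)
  map_one' := rfl
  map_mul' _ _ := rfl

/-- The internal semidirect product `H_n ⋊ S_n` in `Sym(X_n)`, where `S_n` is the group of
isometric permutations of the rays, which normalises `H_n` and meets it trivially. -/
def HS (n : ℕ) : Subgroup (Equiv.Perm (X n)) := H n ⊔ (rayPerm n).range

/-- `T_i(V)`: the least positive eventual translation length on the `i`-th ray of an element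
of `V`. -/
noncomputable def T {n : ℕ} (V : Subgroup (Equiv.Perm (X n))) (i : Fin n) : ℕ :=
  sInf {k : ℕ | 0 < k ∧ ∃ u ∈ V, EventualTranslation u i k}

/-- Given positive integers `r_i`, cut the `i`-th ray of `X_n` into its `r_i` residue classes
modulo `r_i`; the point with number `d + r_i * k` becomes the `k`-th point of the `d`-th class. -/
def splitRays {n : ℕ} (r : Fin n → ℕ) (hr : ∀ i, 0 < r i) : X n ≃ (Σ i : Fin n, Fin (r i)) × ℕ where
  toFun x := (⟨x.1, ⟨x.2 % r x.1, Nat.mod_lt _ (hr x.1)⟩⟩, x.2 / r x.1)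
  invFun y := (y.1.1, y.1.2 + r y.1.1 * y.2)
  left_inv x := by simp [Nat.mod_add_div]
  right_inv := by
    rintro ⟨⟨i, d⟩, k⟩
    simp [Nat.mod_eq_of_lt d.2, Nat.add_mul_div_left _ _ (hr i), Nat.div_eq_of_lt d.2]

/-- The bijection `X_n → X_{r_1 + ⋯ + r_n}` which sends the `d`-th residue class of the `i`-th ray,
in order, to the ray with number `r_1 + ⋯ + r_{i-1} + d`. -/
def refineRays {n : ℕ} (r : Fin n → ℕ) (hr : ∀ i, 0 < r i) : X n ≃ X (∑ i, r i) :=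
  (splitRays r hr).trans (Equiv.prodCongr finSigmaFinEquiv (Equiv.refl ℕ))

/-- The image of the normaliser of `V` in `Sym(X_n)` under the isomorphism of `Sym(X_n)` with
`Sym(X_{T_1(V) + ⋯ + T_n(V)})` that `refineRays` induces. -/
noncomputable def refinedNormalizer {n : ℕ} (V : Subgroup (Equiv.Perm (X n))) (hT : ∀ i, 0 < T V i) :
    Subgroup (Equiv.Perm (X (∑ i, T V i))) :=
  (Subgroup.normalizer (V : Set (Equiv.Perm (X n)))).map
    (refineRays (T V) hT).permCongrHom.toMonoidHom

end Houghton

/-!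
Two of the infinitely many transpositions moving a given point are congruent modulo the normal
core of `V`, so this core contains a 3-cycle, hence `FAlt`. An automorphism of a group `V ≥ FAlt`
is then conjugation by a permutation: 3-cycles are the nontrivial `f ∈ V` with `f ^ 3 = 1`
for which the product of `f` with each of its conjugates under `FAlt` has order dividing 120,
and pairs of 3-cycles `(a b x)`, `(a b y)`, whose product has order 2, are sent to 3-cycles with
a common edge. So `U_m` is characteristic in `V` as soon as the normalizer of `V` normalizes
`U_m`.

Cutting the `i`-th ray into `T_i` rays makes every ray carry an element of translation length 1.
A permutation normalizing the refined group `W ≤ H_T` then sends the end of every ray onto an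
arithmetic progression in some ray, of step 1 because the inverse does the same; hence it lies
in `H_T ⋊ S_T`. Conjugation by it permutes the translation lengths, so it preserves divisibility
by `p`. The commutator of two elements of `H_n` lies in `FSym`, which is central of exponent 2
modulo `FAlt`; fourth powers are therefore multiplicative modulo `FAlt`, and the normalizer of
`V` maps `(g_i ^ p) ^ 4` into `U_{4p}`.

The parity of the commutator of `g` and `h` is that of `∑ t_i(g) t_i(h)`, by bilinearity and a
check on the generators `g_i`. The sum is even if all `t_i(h)` are even. It is also even for
`n = 2`, since `∑ t_i(h) = 0` while the lengths of an element of the refined group are `±a` for a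
fixed `a`.
-/

namespace Houghton

open Equiv
open scoped commutatorElement

section Finitary

variable {α : Type*}

theorem swap_mul_swap_mem_FAlt [DecidableEq α] {a b c d : α} (hab : a ≠ b) (hcd : c ≠ d) :
    swap a b * swap c d ∈ FAlt α := by
  refine ⟨[swap a b, swap c d], ?_, by simp, by simp⟩
  simp only [List.mem_cons, List.not_mem_nil, or_false, forall_eq_or_imp, forall_eq]
  exact ⟨⟨a, b, hab, by congr!⟩, ⟨c, d, hcd, by congr!⟩⟩

theorem FAlt_le_of_swap_mul_swap_mem [DecidableEq α] {K : Subgroup (Perm α)}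
    (hK : ∀ a b c d : α, a ≠ b → c ≠ d → swap a b * swap c d ∈ K) : FAlt α ≤ K := by
  rintro _ ⟨l, hl, ⟨k, hk⟩, rfl⟩
  induction k generalizing l with
  | zero => simp [List.length_eq_zero_iff.1 hk]
  | succ k ih =>
    match l, hl, hk with
    | [σ], _, hk => exact absurd hk (by rw [List.length_singleton]; omega)
    | σ :: τ :: l, hl, hk =>
      obtain ⟨a, b, hab, rfl⟩ := hl σ (by simp)
      obtain ⟨c, d, hcd, rfl⟩ := hl τ (by simp)
      rw [List.prod_cons, List.prod_cons, ← mul_assoc]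
      refine K.mul_mem ?_ (ih l (fun ρ hρ => hl ρ (by simp [hρ])) ?_)
      · convert hK a b c d hab hcd using 3
      · rw [List.length_cons, List.length_cons] at hk
        omega

instance FAlt_normal (α : Type*) : (FAlt α).Normal where
  conj_mem f hf g := by
    classical
    suffices FAlt α ≤ (FAlt α).comap (MulAut.conj g).toMonoidHom from this hf
    refine FAlt_le_of_swap_mul_swap_mem fun a b c d hab hcd => ?_
    have h := swap_mul_swap_mem_FAlt (g.injective.ne hab) (g.injective.ne hcd)
    simpa [swap_apply_apply, mul_assoc] using h

theorem FSym_eq_closure [DecidableEq α] : FSym α = Subgroup.closure {σ | σ.IsSwap} := by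
  ext f
  rw [mem_closure_isSwap']
  rfl

theorem swap_mem_FSym [DecidableEq α] {a b : α} (hab : a ≠ b) : swap a b ∈ FSym α := by
  rw [FSym_eq_closure]
  exact Subgroup.subset_closure ⟨a, b, hab, rfl⟩

theorem mk_swap_eq_mk_swap [DecidableEq α] {a b c d : α} (hab : a ≠ b) (hcd : c ≠ d) :
    (QuotientGroup.mk (swap a b) : Perm α ⧸ FAlt α) = QuotientGroup.mk (swap c d) := by
  rw [QuotientGroup.eq, swap_inv]
  exact swap_mul_swap_mem_FAlt hab hcd

theorem mk_mem_center_of_mem_FSym {f : Perm α} (hf : f ∈ FSym α) :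
    (QuotientGroup.mk f : Perm α ⧸ FAlt α) ∈ Subgroup.center (Perm α ⧸ FAlt α) := by
  classical
  suffices FSym α ≤ (Subgroup.center _).comap (QuotientGroup.mk' (FAlt α)) from this hf
  rw [FSym_eq_closure, Subgroup.closure_le]
  rintro _ ⟨a, b, hab, rfl⟩
  refine Subgroup.mem_center_iff.2 fun x => ?_
  obtain ⟨g, rfl⟩ := QuotientGroup.mk_surjective x
  have hconj : g * swap a b = swap (g a) (g b) * g := by
    rw [swap_apply_apply, inv_mul_cancel_right]
  rw [QuotientGroup.mk'_apply, ← QuotientGroup.mk_mul, hconj, QuotientGroup.mk_mul,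
    mk_swap_eq_mk_swap hab (g.injective.ne hab)]

theorem sq_mem_FAlt_of_mem_FSym {f : Perm α} (hf : f ∈ FSym α) : f ^ 2 ∈ FAlt α := by
  classical
  rw [FSym_eq_closure] at hf
  induction hf using Subgroup.closure_induction with
  | mem σ hσ =>
    obtain ⟨a, b, -, rfl⟩ := hσ
    rw [sq, swap_mul_self]
    exact (FAlt α).one_mem
  | one => simp
  | mul f g hf _ hf₂ hg₂ =>
    rw [← FSym_eq_closure] at hf
    have hcomm : Commute (QuotientGroup.mk f : Perm α ⧸ FAlt α) (QuotientGroup.mk g) :=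
      (Subgroup.mem_center_iff.1 (mk_mem_center_of_mem_FSym hf) _).symm
    rw [← QuotientGroup.eq_one_iff, QuotientGroup.mk_pow] at hf₂ hg₂ ⊢
    rw [QuotientGroup.mk_mul, hcomm.mul_pow, hf₂, hg₂, one_mul]
  | inv f _ hf₂ =>
    rw [inv_pow]
    exact (FAlt α).inv_mem hf₂

theorem commutator_mem_FAlt {f : Perm α} (hf : f ∈ FSym α) (g : Perm α) : ⁅f, g⁆ ∈ FAlt α := by
  rw [← QuotientGroup.eq_one_iff]
  exact (map_commutatorElement (QuotientGroup.mk' (FAlt α)) f g).trans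
    (commutatorElement_eq_one_iff_mul_comm.2
      (Subgroup.mem_center_iff.1 (mk_mem_center_of_mem_FSym hf) _).symm)

end Finitary

section ThreeCycles

variable {α : Type*} [DecidableEq α]

/-- The three-cycle `a ↦ b ↦ c ↦ a`, for distinct points `a`, `b` and `c`. -/
def threeCycle (a b c : α) : Perm α := swap a b * swap b c

/-- The three-cycles, on a type which need not be finite (Mathlib's `Equiv.Perm.IsThreeCycle`
requires finiteness). -/
def IsThreeCycle (f : Perm α) : Prop :=
  ∃ a b c : α, a ≠ b ∧ b ≠ c ∧ a ≠ c ∧ f = threeCycle a b c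

variable {a b c : α} {f : Perm α}

theorem threeCycle_apply_fst (hab : a ≠ b) (hac : a ≠ c) : threeCycle a b c a = b := by
  simp [threeCycle, swap_apply_of_ne_of_ne hab hac]

theorem threeCycle_apply_snd (hbc : b ≠ c) (hac : a ≠ c) : threeCycle a b c b = c := by
  simp [threeCycle, swap_apply_of_ne_of_ne hac.symm hbc.symm]

theorem threeCycle_apply_thd : threeCycle a b c c = a := by
  simp [threeCycle]

theorem threeCycle_apply_of_ne {x : α} (ha : x ≠ a) (hb : x ≠ b) (hc : x ≠ c) :
    threeCycle a b c x = x := by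
  simp [threeCycle, swap_apply_of_ne_of_ne, *]

theorem eq_threeCycle_of_apply (hab : a ≠ b) (hbc : b ≠ c) (hac : a ≠ c) (h₁ : f a = b)
    (h₂ : f b = c) (h₃ : f c = a) (h : ∀ x, x ≠ a → x ≠ b → x ≠ c → f x = x) :
    f = threeCycle a b c := by
  ext x
  by_cases ha : x = a
  · rw [ha, h₁, threeCycle_apply_fst hab hac]
  by_cases hb : x = b
  · rw [hb, h₂, threeCycle_apply_snd hbc hac]
  by_cases hc : x = c
  · rw [hc, h₃, threeCycle_apply_thd]
  rw [h x ha hb hc, threeCycle_apply_of_ne ha hb hc]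

theorem threeCycle_rotate (hab : a ≠ b) (hbc : b ≠ c) (hac : a ≠ c) :
    threeCycle a b c = threeCycle b c a :=
  (eq_threeCycle_of_apply hab hbc hac threeCycle_apply_thd (threeCycle_apply_fst hbc hab.symm)
    (threeCycle_apply_snd hac.symm hab.symm) fun _ ha hb hc => threeCycle_apply_of_ne hb hc ha).symm

theorem conj_threeCycle (g : Perm α) :
    g * threeCycle a b c * g⁻¹ = threeCycle (g a) (g b) (g c) := by
  simp only [threeCycle, swap_apply_apply]
  group

theorem IsThreeCycle.eq_threeCycle (hf : IsThreeCycle f) {x : α} (hx : f x ≠ x) :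
    x ≠ f x ∧ f x ≠ f (f x) ∧ x ≠ f (f x) ∧ f = threeCycle x (f x) (f (f x)) := by
  obtain ⟨a, b, c, hab, hbc, hac, rfl⟩ := hf
  have h₁ := threeCycle_apply_fst hab hac
  have h₂ := threeCycle_apply_snd hbc hac
  have h₃ : threeCycle a b c c = a := threeCycle_apply_thd
  have hrot := threeCycle_rotate hab hbc hac
  obtain rfl | rfl | rfl : x = a ∨ x = b ∨ x = c := by
    by_contra! h
    exact hx (threeCycle_apply_of_ne h.1 h.2.1 h.2.2)
  · rw [h₁, h₂]
    exact ⟨hab, hbc, hac, rfl⟩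
  · rw [h₂, h₃]
    exact ⟨hbc, hac.symm, hab.symm, hrot⟩
  · rw [h₃, h₁]
    exact ⟨hac.symm, hab, hbc.symm, hrot.trans (threeCycle_rotate hbc hac.symm hab.symm)⟩

theorem IsThreeCycle.apply_apply_apply (hf : IsThreeCycle f) (x : α) : f (f (f x)) = x := by
  by_cases hx : f x = x
  · rw [hx, hx, hx]
  obtain ⟨-, -, -, h⟩ := hf.eq_threeCycle hx
  generalize f x = b at *
  generalize f b = c at *
  rw [h, threeCycle_apply_thd]

theorem IsThreeCycle.pow_three (hf : IsThreeCycle f) : f ^ 3 = 1 :=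
  Equiv.ext fun x => by simpa [pow_succ] using hf.apply_apply_apply x

theorem IsThreeCycle.eq_or_eq_or_eq (hf : IsThreeCycle f) {x y : α} (hx : f x ≠ x) (hy : f y ≠ y) :
    y = x ∨ y = f x ∨ y = f (f x) := by
  obtain ⟨-, -, -, h⟩ := hf.eq_threeCycle hx
  by_contra! hc
  exact hy (by rw [h, threeCycle_apply_of_ne hc.1 hc.2.1 hc.2.2])

theorem IsThreeCycle.ne_one (hf : IsThreeCycle f) : f ≠ 1 := by
  obtain ⟨a, b, c, hab, -, hac, rfl⟩ := hf
  intro h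
  have hb := threeCycle_apply_fst hab hac
  rw [h, Perm.one_apply] at hb
  exact hab hb

theorem IsThreeCycle.mem_FAlt (hf : IsThreeCycle f) : f ∈ FAlt α := by
  obtain ⟨a, b, c, hab, hbc, -, rfl⟩ := hf
  exact swap_mul_swap_mem_FAlt hab hbc

theorem IsThreeCycle.conj (hf : IsThreeCycle f) (g : Perm α) : IsThreeCycle (g * f * g⁻¹) := by
  obtain ⟨a, b, c, hab, hbc, hac, rfl⟩ := hf
  exact ⟨g a, g b, g c, g.injective.ne hab, g.injective.ne hbc, g.injective.ne hac,
    conj_threeCycle g⟩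

theorem swap_mul_swap_mem_of_threeCycle_mem {K : Subgroup (Perm α)}
    (hK : ∀ x, x ≠ a → x ≠ b → threeCycle a b x ∈ K) {x y : α} (hxy : x ≠ y) :
    swap a b * swap x y ∈ K := by
  have hmem : ∀ z, z ≠ b → swap a b * swap b z ∈ K := by
    intro z hzb
    by_cases hza : z = a
    · rw [hza, swap_comm b a, swap_mul_self]
      exact K.one_mem
    · exact hK z hza hzb
  by_cases hxb : x = b
  · rw [hxb]
    exact hmem y (hxb ▸ hxy.symm)
  by_cases hyb : y = b
  · rw [hyb, swap_comm x b]
    exact hmem x hxb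
  have hswap : swap x y = swap b x * swap b y * swap b x := by
    have h := swap_apply_apply (swap b x) b y
    rwa [swap_apply_left, swap_apply_of_ne_of_ne hyb hxy.symm, swap_inv] at h
  have hprod : swap a b * swap x y =
      (swap a b * swap b x) * (swap a b * swap b y)⁻¹ * (swap a b * swap b x) := by
    simp only [hswap, mul_inv_rev, swap_inv, mul_assoc, swap_mul_self_mul]
  rw [hprod]
  exact K.mul_mem (K.mul_mem (hmem x hxb) (K.inv_mem (hmem y hyb))) (hmem x hxb)

theorem FAlt_le_of_threeCycle_mem {K : Subgroup (Perm α)}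
    (hK : ∀ x, x ≠ a → x ≠ b → threeCycle a b x ∈ K) : FAlt α ≤ K := by
  refine FAlt_le_of_swap_mul_swap_mem fun x y z w hxy hzw => ?_
  have hprod : swap x y * swap z w = (swap a b * swap x y)⁻¹ * (swap a b * swap z w) := by
    rw [mul_inv_rev, swap_inv, swap_inv, mul_assoc, swap_mul_self_mul]
  rw [hprod]
  exact K.mul_mem (K.inv_mem (swap_mul_swap_mem_of_threeCycle_mem hK hxy))
    (swap_mul_swap_mem_of_threeCycle_mem hK hzw)

end ThreeCycles

section ThreeCycleCriterion

variable {α : Type*}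

theorem pow_add_mul_ne_one {w : Perm α} {a : α} {m r : ℕ} (hm : (w ^ m) a = a)
    (hr : (w ^ r) a ≠ a) (n : ℕ) : w ^ (r + m * n) ≠ 1 := by
  intro h
  refine hr ?_
  calc (w ^ r) a = (w ^ (r + m * n)) a := by
        rw [pow_add, pow_mul, Perm.mul_apply, Perm.pow_apply_eq_self_of_apply_eq_self hm]
    _ = a := by rw [h, Perm.one_apply]

theorem pow_card_factorial_eq_one {w : Perm α} {S : Finset α} (hw : ∀ x, x ∉ S → w x = x) :
    w ^ S.card.factorial = 1 := by
  classical
  have hmem : ∀ x, w x ∈ S ↔ x ∈ S := by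
    have hsub : ∀ x, x ∈ S → w x ∈ S := fun x hx => by
      by_contra h
      exact h (by rwa [w.injective (hw _ h)])
    refine fun x => ⟨fun h => ?_, hsub x⟩
    by_contra hx
    exact hx (hw x hx ▸ h)
  have hcard : Fintype.card (Perm {x // x ∈ S}) = S.card.factorial := by
    rw [Fintype.card_perm, Fintype.card_coe]
  rw [← Perm.ofSubtype_subtypePerm hmem fun x hx => by_contra fun h => hx (hw x h), ← map_pow,
    ← hcard, pow_card_eq_one, map_one]

variable [DecidableEq α]

theorem IsThreeCycle.mul_pow_eq_one {f f' : Perm α} (hf : IsThreeCycle f)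
    (hf' : IsThreeCycle f') : (f * f') ^ 120 = 1 := by
  by_cases hdisj : Perm.Disjoint f f'
  · rw [hdisj.commute.mul_pow, show 120 = 3 * 40 from rfl, pow_mul, pow_mul, hf.pow_three,
      hf'.pow_three, one_pow, one_mul]
  obtain ⟨x, hx, hx'⟩ : ∃ x, f x ≠ x ∧ f' x ≠ x := by
    simpa [Perm.disjoint_iff_eq_or_eq] using hdisj
  have hfix : ∀ z, z ∉ ({x, f x, f (f x), f' x, f' (f' x)} : Finset α) → (f * f') z = z := by
    intro z hz
    simp only [Finset.mem_insert, Finset.mem_singleton, not_or] at hz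
    have hz₁ : f z = z := by
      by_contra h
      have := hf.eq_or_eq_or_eq hx h
      tauto
    have hz₂ : f' z = z := by
      by_contra h
      have := hf'.eq_or_eq_or_eq hx' h
      tauto
    rw [Perm.mul_apply, hz₂, hz₁]
  obtain ⟨k, hk⟩ := Nat.factorial_dvd_factorial
    (Finset.card_le_five (a := x) (b := f x) (c := f (f x)) (d := f' x) (e := f' (f' x)))
  rw [show 120 = Nat.factorial 5 from rfl, hk, pow_mul, pow_card_factorial_eq_one hfix, one_pow]

/- The conjugating element links the two orbits `a, b, c` and `d, e, k` of `f` and the orbit of `y`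
to a single orbit of the product, of length 7 if `f` fixes `y` and of length 9 otherwise. -/
theorem mul_conj_pow_ne_one {f : Perm α} (hf : ∀ x, f (f (f x)) = x) {a b c d e k y : α}
    (hab : f a = b) (hbc : f b = c) (hde : f d = e) (hek : f e = k)
    (hne : [a, b, c, d, e, k, y].Nodup) :
    (f * (swap a d * swap b y * f * (swap a d * swap b y)⁻¹)) ^ 120 ≠ 1 := by
  have hca : f c = a := by rw [← hbc, ← hab, hf]
  have hkd : f k = d := by rw [← hek, ← hde, hf]
  simp only [List.nodup_cons, List.mem_cons, List.not_mem_nil, or_false, not_or, not_false_iff,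
    List.nodup_nil, and_true] at hne
  have hg : ∀ x, (swap a d * swap b y) x = swap a d (swap b y x) := fun x => rfl
  generalize swap a d * swap b y = g at *
  have hga : g a = d := by grind
  have hgb : g b = y := by grind
  have hgd : g d = a := by grind
  have hgy : g y = b := by grind
  have hgfix : ∀ x, x ≠ a → x ≠ b → x ≠ d → x ≠ y → g x = x := by grind
  clear hg
  have hwg : ∀ x, (f * (g * f * g⁻¹)) (g x) = f (g (f x)) := fun x => by simp
  generalize f * (g * f * g⁻¹) = w at *
  have hwa : w a = k := by grind
  have hwk : w k = b := by grind
  have hwc : w c = e := by grind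
  have hwe : w e = d := by grind
  have hwy : w y = a := by grind
  by_cases hy : f y = y
  · have hwb : w b = c := by grind
    have hwd : w d = y := by grind
    have hseven : (w ^ 7) a = a := by simp [pow_succ, *]
    exact pow_add_mul_ne_one (r := 1) hseven (by rw [pow_one, hwa]; grind) 17
  · have hgy' : g (f y) = f y := hgfix _ (by grind) (by grind) (by grind) hy
    have hgy'' : g (f (f y)) = f (f y) :=
      hgfix _ (by grind) (by grind) (by grind) (by grind)
    have hwb : w b = f (f y) := by rw [← hgy, hwg, hgy']
    have hwy'' : w (f (f y)) = c := by rw [← hgy'', hwg, hf, hgy, hbc]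
    have hwd : w d = f y := by rw [← hga, hwg, hab, hgb]
    have hwy' : w (f y) = y := by rw [← hgy', hwg, hgy'', hf]
    have hnine : (w ^ 9) a = a := by simp [pow_succ, *]
    have hthree : (w ^ 3) a = f (f y) := by simp [pow_succ, *]
    exact pow_add_mul_ne_one hnine (by rw [hthree]; grind) 13

theorem isThreeCycle_of_forall_mul_conj_pow_eq_one [Infinite α] {f : Perm α} (hf : f ≠ 1)
    (hf₃ : f ^ 3 = 1) (h : ∀ g ∈ FAlt α, (f * (g * f * g⁻¹)) ^ 120 = 1) : IsThreeCycle f := by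
  have hf₃' : ∀ x, f (f (f x)) = x := fun x => by
    simpa [pow_succ] using congrArg (fun g : Perm α => g x) hf₃
  obtain ⟨a, ha⟩ : ∃ a, f a ≠ a := by
    by_contra! hfix
    exact hf (Equiv.ext hfix)
  have hb : f a ≠ f (f a) := fun h => ha (f.injective h.symm)
  have hc : a ≠ f (f a) := by grind
  refine ⟨a, f a, f (f a), ha.symm, hb, hc,
    eq_threeCycle_of_apply ha.symm hb hc rfl rfl (hf₃' a) fun d hda hdb hdc => ?_⟩
  by_contra hd
  obtain ⟨y, hy⟩ :=
    Infinite.exists_notMem_finset ({a, f a, f (f a), d, f d, f (f d)} : Finset α)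
  have hne : [a, f a, f (f a), d, f d, f (f d), y].Nodup := by
    simp only [Finset.mem_insert, Finset.mem_singleton, not_or] at hy
    have hinj := f.injective
    simp only [List.nodup_cons, List.mem_cons, List.not_mem_nil, or_false, not_or, not_false_iff,
      List.nodup_nil, and_true]
    refine ⟨⟨?_, ?_, ?_, ?_, ?_, ?_⟩, ⟨?_, ?_, ?_, ?_, ?_⟩, ⟨?_, ?_, ?_, ?_⟩, ⟨?_, ?_, ?_⟩,
      ⟨?_, ?_⟩, ?_⟩ <;> grind
  refine mul_conj_pow_ne_one hf₃' rfl rfl rfl rfl hne (h _ (swap_mul_swap_mem_FAlt ?_ ?_))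
  · exact Ne.symm hda
  · rintro rfl
    simp at hne

end ThreeCycleCriterion

section CommonEdge

variable {α : Type*} [DecidableEq α]

theorem IsThreeCycle.mul_eq_one_of_apply_eq {f f' : Perm α} (hf : IsThreeCycle f)
    (hf' : IsThreeCycle f') {p : α} (hp : f' p ≠ p) (h₁ : f (f' p) = p)
    (h₂ : f' (f' p) = f p) : f * f' = 1 := by
  have hfp : f p ≠ p := fun h => hp (f.injective (h₁.trans h.symm))
  have h₃ : f (f p) = f' p := by rw [← hf.apply_apply_apply (f' p), h₁]
  ext x
  rw [Perm.mul_apply, Perm.one_apply]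
  by_cases hx : f' x = x
  · rw [hx]
    by_contra hfx
    have := hf.eq_or_eq_or_eq hfp hfx
    have := hf'.apply_apply_apply p
    grind
  · rcases hf'.eq_or_eq_or_eq hp hx with rfl | rfl | rfl
    · exact h₁
    · rw [h₂, h₃]
    · rw [hf'.apply_apply_apply, h₂]

theorem IsThreeCycle.exists_common_edge {f f' : Perm α} (hf : IsThreeCycle f)
    (hf' : IsThreeCycle f') (hne : f * f' ≠ 1) (hsq : (f * f') ^ 2 = 1) :
    ∃ s, f s ≠ s ∧ f' s = f s := by
  have hsq' : ∀ x, f (f' (f (f' x))) = x := fun x => by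
    simpa [pow_succ] using congrArg (fun g : Perm α => g x) hsq
  by_cases hv : ∃ v, f' v ≠ v ∧ f v = v
  · obtain ⟨v, hv', hv⟩ := hv
    have h := hsq' (f' (f' v))
    rw [hf'.apply_apply_apply, hv] at h
    refine ⟨f' v, ?_, h.symm⟩
    rw [h]
    exact fun h => hv' (f'.injective h)
  push Not at hv
  obtain ⟨p, hp⟩ : ∃ p, f' p ≠ p := by
    by_contra! hfix
    exact hf'.ne_one (Equiv.ext hfix)
  have hp₁ : f' (f' p) ≠ f' p := f'.injective.ne hp
  have hp₂ : f' (f' p) ≠ p := fun h => hp (by simpa [h] using hf'.apply_apply_apply p)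
  have hfp := hv p hp
  rcases hf.eq_or_eq_or_eq hfp (hv _ hp₁) with h | h | h
  · exact absurd h hp
  · exact ⟨p, hfp, h⟩
  · refine absurd (hf.mul_eq_one_of_apply_eq hf' hp (by rw [h, hf.apply_apply_apply]) ?_) hne
    rcases hf.eq_or_eq_or_eq hfp (hv (f' (f' p)) (f'.injective.ne hp₁)) with h' | h' | h'
    · exact absurd h' hp₂
    · exact h'
    · exact absurd (h'.trans h.symm) hp₁

theorem IsThreeCycle.apply_eq_of_common_edges {f f' k : Perm α} (hf : IsThreeCycle f)
    (hf' : IsThreeCycle f') (hk : IsThreeCycle k) {s : α} (hs : f s ≠ s) (hs' : f' s = f s)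
    (hne : f ≠ f') (h : ∃ u, f u ≠ u ∧ k u = f u) (h' : ∃ u, f' u ≠ u ∧ k u = f' u) :
    k s = f s := by
  obtain ⟨u, hu, hku⟩ := h
  obtain ⟨u', hu', hku'⟩ := h'
  have hs₁ : f' s ≠ s := hs' ▸ hs
  have hthird : f (f s) ≠ f' (f' s) := fun h => hne <| by
    rw [(hf.eq_threeCycle hs).2.2.2, (hf'.eq_threeCycle hs₁).2.2.2, h, hs']
  have hkmoved : ∀ x y, k x ≠ x → k y ≠ y → y = x ∨ y = k x ∨ y = k (k x) :=
    fun x y => hk.eq_or_eq_or_eq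
  have hf₃ := hf.apply_apply_apply s
  have hf'₃ := hf'.apply_apply_apply s
  have hkinj := k.injective
  rcases hf.eq_or_eq_or_eq hs hu with rfl | rfl | rfl
  · exact hku
  · rcases hf'.eq_or_eq_or_eq hs₁ hu' with rfl | rfl | rfl <;> grind [hk.apply_apply_apply]
  · rcases hf'.eq_or_eq_or_eq hs₁ hu' with rfl | rfl | rfl <;> grind [hk.apply_apply_apply]

theorem exists_ne_forall_apply_eq {ι : Type*} [Nontrivial ι] {F : ι → Perm α}
    (hF : ∀ i, IsThreeCycle (F i)) (hinj : Function.Injective F)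
    (hne : ∀ i j, i ≠ j → F i * F j ≠ 1) (hsq : ∀ i j, i ≠ j → (F i * F j) ^ 2 = 1) :
    ∃ p q, p ≠ q ∧ ∀ i, F i p = q := by
  have hedge : ∀ i j, ∃ s, F i s ≠ s ∧ F j s = F i s := by
    intro i j
    rcases eq_or_ne i j with rfl | hij
    · by_contra! hfix
      exact (hF i).ne_one (Equiv.ext fun x => by_contra fun h => hfix x h rfl)
    · exact (hF i).exists_common_edge (hF j) (hne i j hij) (hsq i j hij)
  obtain ⟨i, j, hij⟩ := exists_pair_ne ι
  obtain ⟨p, hp, hp'⟩ := hedge i j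
  exact ⟨p, F i p, hp.symm, fun k => (hF i).apply_eq_of_common_edges (hF j) (hF k) hp hp'
    (hinj.ne hij) (hedge i k) (hedge j k)⟩

theorem threeCycle_mul_threeCycle_sq {a b x y : α} (hab : a ≠ b) (hax : a ≠ x) (hay : a ≠ y)
    (hbx : b ≠ x) (hxy : x ≠ y) : (threeCycle a b x * threeCycle a b y) ^ 2 = 1 := by
  have hswap : swap a x * swap a b = swap a b * swap b x := by
    have h := swap_apply_apply (swap a b) b x
    rw [swap_apply_right, swap_apply_of_ne_of_ne hax.symm hbx.symm, swap_inv] at h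
    rw [h, mul_assoc, swap_mul_self, mul_one]
  have hprod : threeCycle a b x * threeCycle a b y = swap a x * swap b y := by
    rw [threeCycle, threeCycle, ← hswap, mul_assoc, swap_mul_self_mul]
  have hdisj : Perm.Disjoint (swap a x) (swap b y) := Perm.disjoint_iff_eq_or_eq.2 fun z => by
    grind
  rw [hprod, hdisj.commute.mul_pow, sq, sq, swap_mul_self, swap_mul_self, one_mul]

theorem threeCycle_mul_threeCycle_ne_one {a b x y : α} (hab : a ≠ b) (hax : a ≠ x) (hbx : b ≠ x)
    (hay : a ≠ y) : threeCycle a b x * threeCycle a b y ≠ 1 := by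
  intro h
  have ha : threeCycle a b x (threeCycle a b y a) = a := congrArg (fun g : Perm α => g a) h
  rw [threeCycle_apply_fst hab hay, threeCycle_apply_snd hbx hax] at ha
  exact hax ha.symm

end CommonEdge

section Automorphisms

variable {α : Type*} {V : Subgroup (Perm α)}

theorem FAlt_subgroupOf_le_of_threeCycle_mem [DecidableEq α] (hV : FAlt α ≤ V) {K : Subgroup V}
    {a b : α} (hab : a ≠ b)
    (hK : ∀ x, x ≠ a → x ≠ b → ∀ f : V, (f : Perm α) = threeCycle a b x → f ∈ K) :
    (FAlt α).subgroupOf V ≤ K := by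
  have hle : FAlt α ≤ K.map V.subtype := FAlt_le_of_threeCycle_mem fun x hxa hxb =>
    ⟨⟨_, hV (swap_mul_swap_mem_FAlt hab hxb.symm)⟩, hK x hxa hxb _ rfl, rfl⟩
  intro f hf
  obtain ⟨g, hg, hgf⟩ := hle hf
  rwa [← Subtype.ext hgf]

variable [Infinite α]

theorem IsThreeCycle.map_mulEquiv [DecidableEq α] (hV : FAlt α ≤ V) (e : V ≃* V) {f : V}
    (hf : IsThreeCycle (f : Perm α)) : IsThreeCycle (e f : Perm α) := by
  apply isThreeCycle_of_forall_mul_conj_pow_eq_one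
  · intro h
    rw [OneMemClass.coe_eq_one, map_eq_one_iff e e.injective, ← OneMemClass.coe_eq_one] at h
    exact hf.ne_one h
  · have h : f ^ 3 = 1 := Subtype.ext hf.pow_three
    rw [← Subgroup.coe_pow, ← map_pow, h, map_one, Subgroup.coe_one]
  · intro g hg
    obtain ⟨g', hg'⟩ := e.surjective ⟨g, hV hg⟩
    have h : (f * (g' * f * g'⁻¹)) ^ 120 = 1 := Subtype.ext (hf.mul_pow_eq_one (hf.conj g'))
    simpa [hg'] using congrArg (fun v => (e v : Perm α)) h

theorem exists_map_threeCycle_apply_eq [DecidableEq α] (hV : FAlt α ≤ V) (e : V ≃* V) {a b : α}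
    (hab : a ≠ b) : ∃ p q : α, p ≠ q ∧ ∀ x, x ≠ a → x ≠ b →
      ∀ f : V, (f : Perm α) = threeCycle a b x → (e f : Perm α) p = q := by
  let ι := {x : α // x ≠ a ∧ x ≠ b}
  have hι : Nontrivial ι := by
    obtain ⟨x, hx⟩ := Infinite.exists_notMem_finset ({a, b} : Finset α)
    obtain ⟨y, hy⟩ := Infinite.exists_notMem_finset ({a, b, x} : Finset α)
    simp only [Finset.mem_insert, Finset.mem_singleton, not_or] at hx hy
    exact ⟨⟨x, hx⟩, ⟨y, hy.1, hy.2.1⟩, fun h => hy.2.2 (congrArg Subtype.val h).symm⟩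
  let c : ι → V := fun x =>
    ⟨threeCycle a b x, hV (swap_mul_swap_mem_FAlt hab x.2.2.symm)⟩
  have hcb : ∀ x, (c x : Perm α) b = x := fun x => threeCycle_apply_snd x.2.2.symm x.2.1.symm
  have hcinj : Function.Injective c := fun x y h => Subtype.ext (by rw [← hcb, h, hcb])
  have hF : ∀ x, IsThreeCycle (e (c x) : Perm α) := fun x =>
    IsThreeCycle.map_mulEquiv hV e ⟨a, b, x, hab, x.2.2.symm, x.2.1.symm, rfl⟩
  have hne : ∀ x y, (e (c x) : Perm α) * e (c y) ≠ 1 := by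
    intro x y h
    have h' : c x * c y = 1 :=
      (map_eq_one_iff e e.injective).1 ((map_mul e _ _).trans (Subtype.ext h))
    exact threeCycle_mul_threeCycle_ne_one hab x.2.1.symm x.2.2.symm y.2.1.symm
      (congrArg Subtype.val h')
  have hsq : ∀ x y, x ≠ y → ((e (c x) : Perm α) * e (c y)) ^ 2 = 1 := by
    intro x y hxy
    have h : (c x * c y) ^ 2 = 1 := Subtype.ext (threeCycle_mul_threeCycle_sq hab x.2.1.symm
      y.2.1.symm x.2.2.symm fun h => hxy (Subtype.ext h))
    simpa using congrArg (fun v => (e v : Perm α)) h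
  obtain ⟨p, q, hpq, hFp⟩ := exists_ne_forall_apply_eq hF
    (Subtype.val_injective.comp (e.injective.comp hcinj)) (fun x y _ => hne x y) hsq
  exact ⟨p, q, hpq, fun x hxa hxb f hf => by
    rw [show f = c ⟨x, hxa, hxb⟩ from Subtype.ext hf, hFp]⟩

theorem exists_map_threeCycle_eq [DecidableEq α] (hV : FAlt α ≤ V) (e : V ≃* V) {a b : α}
    (hab : a ≠ b) : ∃ p q : α, p ≠ q ∧ ∀ x, x ≠ a → x ≠ b → ∃ r, p ≠ r ∧ q ≠ r ∧
      ∀ f : V, (f : Perm α) = threeCycle a b x → (e f : Perm α) = threeCycle p q r := by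
  obtain ⟨p, q, hpq, hp⟩ := exists_map_threeCycle_apply_eq hV e hab
  refine ⟨p, q, hpq, fun x hxa hxb => ?_⟩
  have hx : IsThreeCycle (threeCycle a b x) := ⟨a, b, x, hab, hxb.symm, hxa.symm, rfl⟩
  let c : V := ⟨threeCycle a b x, hV hx.mem_FAlt⟩
  have hcp : (e c : Perm α) p = q := hp x hxa hxb c rfl
  obtain ⟨-, hqr, hpr, h⟩ :=
    (IsThreeCycle.map_mulEquiv hV e hx).eq_threeCycle (x := p) (hcp ▸ hpq.symm)
  rw [hcp] at hqr hpr h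
  exact ⟨_, hpr, hqr, fun f hf => by rw [← h, show f = c from Subtype.ext hf]⟩

theorem exists_injective_map_threeCycle [DecidableEq α] (hV : FAlt α ≤ V) (e : V ≃* V) {a b : α}
    (hab : a ≠ b) : ∃ n : α → α, Function.Injective n ∧
      ∀ x, x ≠ a → x ≠ b → ∀ f : V, (f : Perm α) = threeCycle a b x →
        (e f : Perm α) = threeCycle (n a) (n b) (n x) := by
  obtain ⟨p, q, hpq, h⟩ := exists_map_threeCycle_eq hV e hab
  choose! r hpr hqr hr using h
  have hrinj : ∀ x y, x ≠ a → x ≠ b → y ≠ a → y ≠ b → r x = r y → x = y := by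
    intro x y hxa hxb hya hyb hxy
    let c : ∀ z, z ≠ b → V := fun z hzb =>
      ⟨threeCycle a b z, hV (swap_mul_swap_mem_FAlt hab hzb.symm)⟩
    have hc : e (c x hxb) = e (c y hyb) := Subtype.ext (by
      rw [hr x hxa hxb _ rfl, hr y hya hyb _ rfl, hxy])
    have hb : threeCycle a b x b = threeCycle a b y b :=
      congrArg (fun f : V => (f : Perm α) b) (e.injective hc)
    rwa [threeCycle_apply_snd hxb.symm hxa.symm, threeCycle_apply_snd hyb.symm hya.symm] at hb
  refine ⟨fun x => if x = a then p else if x = b then q else r x, fun x y hxy => ?_,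
    fun x hxa hxb f hf => ?_⟩
  · grind
  · simp [hr x hxa hxb f hf, hxa, hxb, hab.symm]

theorem surjective_of_map_threeCycle [DecidableEq α] (hV : FAlt α ≤ V) (e : V ≃* V) {a b : α}
    (hab : a ≠ b) {n : α → α} (hn : ∀ x, x ≠ a → x ≠ b → ∀ f : V, (f : Perm α) = threeCycle a b x →
      (e f : Perm α) = threeCycle (n a) (n b) (n x)) : Function.Surjective n := by
  intro y
  by_contra! hy
  have hfix : (FAlt α).subgroupOf V ≤
      (MulAction.stabilizer (Perm α) y).comap (V.subtype.comp e.toMonoidHom) := by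
    refine FAlt_subgroupOf_le_of_threeCycle_mem hV hab fun x hxa hxb f hf => ?_
    change (e f : Perm α) y = y
    rw [hn x hxa hxb f hf]
    exact threeCycle_apply_of_ne (hy a).symm (hy b).symm (hy x).symm
  obtain ⟨z, hz⟩ := Infinite.exists_notMem_finset ({y} : Finset α)
  obtain ⟨w, hw⟩ := Infinite.exists_notMem_finset ({y, z} : Finset α)
  simp only [Finset.mem_insert, Finset.mem_singleton, not_or] at hz hw
  have hcyc : IsThreeCycle (threeCycle y z w) :=
    ⟨y, z, w, Ne.symm hz, Ne.symm hw.2, Ne.symm hw.1, rfl⟩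
  let f : V := ⟨threeCycle y z w, hV hcyc.mem_FAlt⟩
  have hy' : (e (e.symm f) : Perm α) y = y :=
    hfix (IsThreeCycle.map_mulEquiv hV e.symm hcyc).mem_FAlt
  rw [e.apply_symm_apply, threeCycle_apply_fst (Ne.symm hz) (Ne.symm hw.1)] at hy'
  exact hz hy'

theorem exists_conj_eq_on_FAlt (hV : FAlt α ≤ V) (e : V ≃* V) :
    ∃ ν : Perm α, ∀ f : V, (f : Perm α) ∈ FAlt α → (e f : Perm α) = ν * f * ν⁻¹ := by
  classical
  obtain ⟨a, b, hab⟩ := exists_pair_ne α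
  obtain ⟨n, hinj, hn⟩ := exists_injective_map_threeCycle hV e hab
  let ν : Perm α := Equiv.ofBijective n ⟨hinj, surjective_of_map_threeCycle hV e hab hn⟩
  suffices (FAlt α).subgroupOf V ≤ (V.subtype.comp e.toMonoidHom).eqLocus
      ((MulAut.conj ν).toMonoidHom.comp V.subtype) from ⟨ν, fun f hf => this hf⟩
  refine FAlt_subgroupOf_le_of_threeCycle_mem hV hab fun x hxa hxb f hf => ?_
  change (e f : Perm α) = ν * f * ν⁻¹
  rw [hn x hxa hxb f hf, hf, conj_threeCycle]
  rfl

theorem eq_one_of_forall_commute_FAlt {g : Perm α} (h : ∀ f ∈ FAlt α, Commute g f) : g = 1 := by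
  classical
  ext x
  rw [Perm.one_apply]
  by_contra hx
  obtain ⟨y, hy⟩ := Infinite.exists_notMem_finset ({x, g x} : Finset α)
  obtain ⟨z, hz⟩ := Infinite.exists_notMem_finset ({x, g x, y} : Finset α)
  simp only [Finset.mem_insert, Finset.mem_singleton, not_or] at hy hz
  have hxy : g (threeCycle x y z x) = threeCycle x y z (g x) := congrArg (fun k : Perm α => k x)
    (h _ (swap_mul_swap_mem_FAlt (Ne.symm hy.1) (Ne.symm hz.2.2))).eq
  rw [threeCycle_apply_fst (Ne.symm hy.1) (Ne.symm hz.1),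
    threeCycle_apply_of_ne hx (Ne.symm hy.2) (Ne.symm hz.2.1)] at hxy
  exact hy.1 (g.injective hxy)

/- Once `e` agrees with conjugation by `ν` on `FAlt`, comparing the two on `v f v⁻¹` for `f` in
`FAlt` shows that `e v` and `ν v ν⁻¹` differ by an element centralising `FAlt`. -/
theorem exists_mem_normalizer_forall_eq_conj (hV : FAlt α ≤ V) (e : V ≃* V) :
    ∃ ν ∈ Subgroup.normalizer (V : Set (Perm α)), ∀ v : V, (e v : Perm α) = ν * v * ν⁻¹ := by
  obtain ⟨ν, hν⟩ := exists_conj_eq_on_FAlt hV e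
  have hconj : ∀ v : V, (e v : Perm α) = ν * v * ν⁻¹ := by
    intro v
    have hcomm : (v : Perm α)⁻¹ * (ν⁻¹ * e v * ν) = 1 := by
      refine eq_one_of_forall_commute_FAlt fun f hf => ?_
      have h₁ := hν ⟨f, hV hf⟩ hf
      have h₂ := hν (v * ⟨f, hV hf⟩ * v⁻¹) ((FAlt_normal α).conj_mem f hf v)
      rw [map_mul, map_mul, map_inv, Subgroup.coe_mul, Subgroup.coe_mul, h₁] at h₂
      simp only [Subgroup.coe_mul, Subgroup.coe_inv] at h₂
      calc (v : Perm α)⁻¹ * (ν⁻¹ * e v * ν) * f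
          = (v : Perm α)⁻¹ * ν⁻¹ * (e v * (ν * f * ν⁻¹) * (e v : Perm α)⁻¹) * e v * ν := by group
        _ = f * ((v : Perm α)⁻¹ * (ν⁻¹ * e v * ν)) := by rw [h₂]; group
    rw [inv_mul_eq_one] at hcomm
    rw [hcomm]
    group
  refine ⟨ν, Subgroup.mem_normalizer_iff.2 fun h => ⟨fun hh => ?_, fun hh => ?_⟩, hconj⟩
  · exact hconj ⟨h, hh⟩ ▸ (e ⟨h, hh⟩).2
  · have hpre := hconj (e.symm ⟨_, hh⟩)
    rw [e.apply_symm_apply, mul_left_inj, mul_right_inj] at hpre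
    exact hpre ▸ (e.symm ⟨_, hh⟩).2

theorem characteristic_subgroupOf_of_normalizer_le {K : Subgroup (Perm α)} (hV : FAlt α ≤ V)
    (hK : Subgroup.normalizer (V : Set (Perm α)) ≤ Subgroup.normalizer (K : Set (Perm α))) :
    (K.subgroupOf V).Characteristic := by
  refine Subgroup.characteristic_iff_le_comap.2 fun e v hv => ?_
  obtain ⟨ν, hν, he⟩ := exists_mem_normalizer_forall_eq_conj hV e
  change (e v : Perm α) ∈ K
  rw [he]
  exact (Subgroup.mem_normalizer_iff.1 (hK hν) v).1 hv

end Automorphisms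

section FiniteIndex

variable {α : Type*}

theorem FAlt_le_of_finiteIndex [Infinite α] {G V : Subgroup (Perm α)} (hG : FSym α ≤ G)
    (hV : (V.subgroupOf G).FiniteIndex) : FAlt α ≤ V := by
  classical
  let N := (V.subgroupOf G).normalCore
  obtain ⟨x, hx⟩ : ∃ x : ℕ → α, Function.Injective x :=
    ⟨_, (Infinite.natEmbedding α).injective⟩
  have hmem : ∀ {y z : α}, y ≠ z → swap y z ∈ G := fun h => hG (swap_mem_FSym h)
  let τ : ℕ → G := fun k => ⟨swap (x 0) (x (k + 1)), hmem (hx.ne k.succ_ne_zero.symm)⟩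
  obtain ⟨i, j, hij, hτ⟩ : ∃ i j, i ≠ j ∧ (τ i : G ⧸ N) = τ j :=
    Finite.exists_ne_map_eq_of_infinite fun k => (τ k : G ⧸ N)
  set o := x 0
  set b := x (i + 1)
  set c := x (j + 1)
  have hoc : o ≠ c := hx.ne j.succ_ne_zero.symm
  have hbc : b ≠ c := hx.ne fun h => hij (Nat.succ_injective h)
  have hN : (τ i)⁻¹ * τ j ∈ N := QuotientGroup.eq.1 hτ
  refine FAlt_le_of_threeCycle_mem (a := b) (b := o) fun y hyb hyo => ?_
  by_cases hyc : y = c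
  · have h := (V.subgroupOf G).normalCore_le hN
    simpa [τ, threeCycle, swap_comm b, hyc] using Subgroup.mem_subgroupOf.1 h
  · have h := (V.subgroupOf G).normalCore_le
      ((V.subgroupOf G).normalCore_normal.conj_mem _ hN ⟨swap c y, hmem (Ne.symm hyc)⟩)
    have hcycle : threeCycle b o y = swap c y * threeCycle b o c * (swap c y)⁻¹ := by
      rw [conj_threeCycle, swap_apply_of_ne_of_ne hbc hyb.symm,
        swap_apply_of_ne_of_ne hoc hyo.symm, swap_apply_left]
    rw [hcycle]
    simpa [τ, threeCycle, swap_comm b] using Subgroup.mem_subgroupOf.1 h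

end FiniteIndex

section Translations

variable {n : ℕ} {g h : Perm (X n)} {i : Fin n}

theorem EventualTranslation.unique {s t : ℤ} (hs : EventualTranslation g i s)
    (ht : EventualTranslation g i t) : s = t := by
  obtain ⟨z, hz⟩ := hs
  obtain ⟨w, hw⟩ := ht
  have h₁ := (hz (z + w) (by omega)).2
  have h₂ := (hw (z + w) (by omega)).2
  omega

open scoped Classical in
/-- The translation length `t_i(g)`, with the value `0` where `g` is not eventually a translation
on the `i`-th ray. -/
noncomputable def translation (g : Perm (X n)) (i : Fin n) : ℤ :=
  if h : ∃ t, EventualTranslation g i t then h.choose else 0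

theorem EventualTranslation.translation_eq {t : ℤ} (ht : EventualTranslation g i t) :
    translation g i = t := by
  have hex : ∃ t, EventualTranslation g i t := ⟨t, ht⟩
  rw [translation, dif_pos hex]
  exact hex.choose_spec.unique ht

theorem eventualTranslation_translation (hg : g ∈ H n) (i : Fin n) :
    EventualTranslation g i (translation g i) := by
  obtain ⟨t, ht⟩ := hg i
  rwa [ht.translation_eq]

theorem translation_one (i : Fin n) : translation (1 : Perm (X n)) i = 0 :=
  (EventualTranslation.one i).translation_eq

theorem translation_mul (hg : g ∈ H n) (hh : h ∈ H n) (i : Fin n) :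
    translation (g * h) i = translation g i + translation h i :=
  ((eventualTranslation_translation hg i).mul (eventualTranslation_translation hh i)).translation_eq

theorem translation_inv (hg : g ∈ H n) (i : Fin n) : translation g⁻¹ i = -translation g i :=
  (eventualTranslation_translation hg i).inv.translation_eq

/-- The translation lengths on all rays, as a homomorphism from `H_n` to `ℤ^n`. -/
noncomputable def translationHom (n : ℕ) : H n →* Multiplicative (Fin n → ℤ) where
  toFun g := Multiplicative.ofAdd (translation (g : Perm (X n)))
  map_one' := congrArg Multiplicative.ofAdd (funext translation_one)
  map_mul' g h := congrArg Multiplicative.ofAdd (funext (translation_mul g.2 h.2))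

theorem translation_zpow (hg : g ∈ H n) (k : ℤ) (i : Fin n) :
    translation (g ^ k) i = k * translation g i := by
  have h := congrArg Multiplicative.toAdd (map_zpow (translationHom n) ⟨g, hg⟩ k)
  simpa [translationHom] using congrFun h i

theorem translation_pow (hg : g ∈ H n) (k : ℕ) (i : Fin n) :
    translation (g ^ k) i = k * translation g i := by
  rw [← zpow_natCast, translation_zpow hg]

theorem exists_forall_ge_apply (hg : g ∈ H n) :
    ∃ z, ∀ i m, z ≤ m → (g (i, m)).1 = i ∧ ((g (i, m)).2 : ℤ) = m + translation g i := by
  choose z hz using eventualTranslation_translation hg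
  exact ⟨Finset.univ.sup z, fun i m hm => hz i m ((Finset.le_sup (Finset.mem_univ i)).trans hm)⟩

theorem finite_setOf_snd_lt (z : ℕ) : {x : X n | x.2 < z}.Finite :=
  (Set.finite_univ.prod (Set.finite_Iio z)).subset fun _ hx => ⟨trivial, hx⟩

theorem eventualTranslation_zero_of_mem_FSym (hg : g ∈ FSym (X n)) (i : Fin n) :
    EventualTranslation g i 0 := by
  obtain ⟨z, hz⟩ := (Set.Finite.image Prod.snd hg).bddAbove
  refine ⟨z + 1, fun m hm => ?_⟩
  have hfix : g (i, m) = (i, m) := by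
    by_contra hne
    have : m ≤ z := hz ⟨(i, m), hne, rfl⟩
    omega
  simp [hfix]

theorem FSym_le_H (n : ℕ) : FSym (X n) ≤ H n :=
  fun _ hg i => ⟨0, eventualTranslation_zero_of_mem_FSym hg i⟩

theorem translation_eq_zero_of_mem_FSym (hg : g ∈ FSym (X n)) (i : Fin n) : translation g i = 0 :=
  (eventualTranslation_zero_of_mem_FSym hg i).translation_eq

theorem mem_FSym_of_translation_eq_zero (hg : g ∈ H n) (h₀ : ∀ i, translation g i = 0) :
    g ∈ FSym (X n) := by
  obtain ⟨z, hz⟩ := exists_forall_ge_apply hg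
  refine (finite_setOf_snd_lt z).subset fun ⟨i, m⟩ hx => ?_
  by_contra hm
  obtain ⟨h₁, h₂⟩ := hz i m (not_lt.1 hm)
  rw [h₀, add_zero] at h₂
  exact hx (Prod.ext h₁ (by exact_mod_cast h₂))

theorem commutator_mem_FSym (hg : g ∈ H n) (hh : h ∈ H n) : ⁅g, h⁆ ∈ FSym (X n) := by
  let g' : H n := ⟨g, hg⟩
  let h' : H n := ⟨h, hh⟩
  have h₀ : translationHom n ⁅g', h'⁆ = 1 := by
    rw [map_commutatorElement, commutatorElement_eq_one_iff_mul_comm, mul_comm]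
  exact mem_FSym_of_translation_eq_zero ⁅g', h'⁆.2 (congrFun (congrArg Multiplicative.toAdd h₀))

theorem sum_translation_eq_zero (hg : g ∈ H n) : ∑ i, translation g i = 0 := by
  obtain ⟨z, hz⟩ := exists_forall_ge_apply hg
  obtain ⟨Z, hZ⟩ : ∃ Z : ℕ, ∀ i, z + (translation g i).natAbs ≤ Z :=
    ⟨_, fun i => Finset.le_sup (f := fun i => z + (translation g i).natAbs) (Finset.mem_univ i)⟩
  -- `g` maps the points at height below `Z` onto the points `y` at height below `Z + t_{y.1}(g)`.
  have hlt : ∀ x, x.2 < Z ↔ (g x).2 < (Z + translation g (g x).1).toNat := by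
    intro x
    have hZx := hZ (g x).1
    constructor
    · contrapose!
      intro hle
      obtain ⟨h₁, h₂⟩ := hz (g x).1 ((g x).2 - translation g (g x).1).toNat (by omega)
      have hgx : ((g x).1, ((g x).2 - translation g (g x).1).toNat) = x :=
        g.injective (Prod.ext h₁ (by omega))
      have := congrArg Prod.snd hgx
      omega
    · contrapose!
      intro hle
      obtain ⟨h₁, h₂⟩ : (g x).1 = x.1 ∧ ((g x).2 : ℤ) = x.2 + translation g x.1 :=
        hz x.1 x.2 (by omega)
      rw [h₁]
      omega
  have hcard : (Finset.univ ×ˢ Finset.range Z : Finset (X n)).card =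
      (Finset.univ.sigma fun i => Finset.range (Z + translation g i).toNat).card :=
    Finset.card_equiv (g.trans (Equiv.sigmaEquivProd _ _).symm) fun x => by simp [hlt x]
  simp only [Finset.card_product, Finset.card_univ, Fintype.card_fin, Finset.card_range,
    Finset.card_sigma] at hcard
  have hsum : ((n * Z : ℕ) : ℤ) = ∑ i, (Z + translation g i) := by
    rw [hcard, Nat.cast_sum]
    exact Finset.sum_congr rfl fun i _ => Int.toNat_of_nonneg (by have := hZ i; omega)
  simpa [Finset.sum_add_distrib] using hsum

end Translations

section Shifts

variable {n : ℕ} {a b : Fin n}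

theorem shift_apply (hab : a ≠ b) (x : X n) : shift a b hab x = shiftFun a b x := rfl

theorem eventualTranslation_shift (hab : a ≠ b) (i : Fin n) :
    EventualTranslation (shift a b hab) i
      ((if i = a then 1 else 0) - (if i = b then 1 else 0)) := by
  refine ⟨1, fun m hm => ?_⟩
  rw [shift_apply, shiftFun]
  rcases eq_or_ne i a with rfl | ha
  · simp [hab]
  rcases eq_or_ne i b with rfl | hb
  · have hm₀ : m ≠ 0 := by omega
    simp only [ha, hm₀, if_false, if_true, true_and]
    omega
  · simp [ha, hb]

theorem shift_mem_H (hab : a ≠ b) : shift a b hab ∈ H n :=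
  fun i => ⟨_, eventualTranslation_shift hab i⟩

theorem translation_shift (hab : a ≠ b) (i : Fin n) :
    translation (shift a b hab) i = (if i = a then 1 else 0) - (if i = b then 1 else 0) :=
  (eventualTranslation_shift hab i).translation_eq

theorem shift_mul_shift {o i j : Fin n} (hi : o ≠ i) (hj : o ≠ j) (hij : i ≠ j) :
    shift o i hi * shift o j hj = swap (o, 0) (o, 1) * (shift o j hj * shift o i hi) := by
  have hswap : ∀ x : X n, x ≠ (o, 0) → x ≠ (o, 1) → swap ((o, 0) : X n) (o, 1) x = x :=
    fun _ => swap_apply_of_ne_of_ne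
  ext1 ⟨k, m⟩
  simp only [Perm.mul_apply, shift_apply]
  rcases eq_or_ne k o with rfl | ho
  · simp [shiftFun, hswap]
  rcases eq_or_ne k i with rfl | hki
  · rcases eq_or_ne m 0 with rfl | hm
    · simp [shiftFun, ho, hij]
    · simp [shiftFun, ho, hij, hm, hswap]
  rcases eq_or_ne k j with rfl | hkj
  · rcases eq_or_ne m 0 with rfl | hm
    · simp [shiftFun, ho, hki]
    · simp [shiftFun, ho, hki, hm, hswap]
  simp [shiftFun, ho, hki, hkj, hswap]

end Shifts

section CongruenceSubgroups

variable {n : ℕ} {g h : Perm (X n)}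

/-- The elements of `H_n` all of whose translation lengths are divisible by `p`; for `p = 1` this
is `H_n`. -/
def congruenceSubgroup (n p : ℕ) : Subgroup (Perm (X n)) where
  carrier := {g | g ∈ H n ∧ ∀ i, (p : ℤ) ∣ translation g i}
  one_mem' := ⟨(H n).one_mem, fun i => by simp [translation_one]⟩
  mul_mem' hg hh := ⟨(H n).mul_mem hg.1 hh.1, fun i => by
    rw [translation_mul hg.1 hh.1]
    exact dvd_add (hg.2 i) (hh.2 i)⟩
  inv_mem' hg := ⟨(H n).inv_mem hg.1, fun i => by
    rw [translation_inv hg.1]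
    exact (hg.2 i).neg_right⟩

theorem exists_mem_forall_translation_eq {p : ℕ} {K : Subgroup (Perm (X n))} (o : Fin n)
    (hs : ∀ (i : Fin n) (hi : o ≠ i), shift o i hi ^ p ∈ K) (hg : g ∈ congruenceSubgroup n p) :
    ∃ f ∈ K, f ∈ H n ∧ translation f = translation g := by
  have hshift : ∀ i, ∃ s ∈ K.subgroupOf (H n), ∀ j, translation (s : Perm (X n)) j =
      p * ((if j = o then 1 else 0) - (if j = i then 1 else 0)) := by
    intro i
    by_cases hi : o = i
    · exact ⟨1, Subgroup.one_mem _, fun j => by simp [hi, translation_one]⟩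
    · refine ⟨⟨_, (H n).pow_mem (shift_mem_H hi) p⟩, hs i hi, fun j => ?_⟩
      rw [translation_pow (shift_mem_H hi), translation_shift]
  choose s hs ht using hshift
  choose k hk using hg.2
  have hmem : ∏ i, translationHom n (s i) ^ (-k i) ∈ (K.subgroupOf (H n)).map (translationHom n) :=
    Subgroup.prod_mem _ fun i _ => Subgroup.zpow_mem _ (Subgroup.mem_map_of_mem _ (hs i)) _
  obtain ⟨f, hf, hfs⟩ := hmem
  refine ⟨f, hf, f.2, ?_⟩
  have hsum : translation (f : Perm (X n)) = ∑ i, -k i • translation (s i : Perm (X n)) := by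
    simpa [translationHom, toAdd_prod] using congrArg Multiplicative.toAdd hfs
  funext j
  -- Only the ray `o` receives contributions from several shifts; there `∑ t_i(g) = 0` is used.
  calc translation (f : Perm (X n)) j
      = ∑ i, -k i * (p * ((if j = o then 1 else 0) - (if j = i then 1 else 0))) := by
        simp [hsum, ht]
    _ = ∑ i, (translation g i * (if j = i then 1 else 0)
          - translation g i * (if j = o then 1 else 0)) :=
        Finset.sum_congr rfl fun i _ => by rw [hk i]; ring
    _ = translation g j := by
        rw [Finset.sum_sub_distrib, ← Finset.sum_mul, sum_translation_eq_zero hg.1]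
        simp

theorem congruenceSubgroup_le {p : ℕ} {K : Subgroup (Perm (X n))} (o : Fin n) (hF : FSym (X n) ≤ K)
    (hs : ∀ (i : Fin n) (hi : o ≠ i), shift o i hi ^ p ∈ K) : congruenceSubgroup n p ≤ K := by
  intro g hg
  obtain ⟨f, hfK, hfH, hfg⟩ := exists_mem_forall_translation_eq o hs hg
  have hmem : g * f⁻¹ ∈ FSym (X n) := by
    refine mem_FSym_of_translation_eq_zero ((H n).mul_mem hg.1 ((H n).inv_mem hfH)) fun i => ?_
    rw [translation_mul hg.1 ((H n).inv_mem hfH), translation_inv hfH, hfg, add_neg_cancel]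
  simpa using K.mul_mem (hF hmem) hfK

theorem H_le_of_shift_mem {K : Subgroup (Perm (X n))} (o : Fin n) (hF : FSym (X n) ≤ K)
    (hs : ∀ (i : Fin n) (hi : o ≠ i), shift o i hi ∈ K) : H n ≤ K := fun g hg =>
  congruenceSubgroup_le (p := 1) o hF (fun i hi => K.pow_mem (hs i hi) 1) ⟨hg, by simp⟩

end CongruenceSubgroups

section Commutators

theorem mul_pow_four_of_commutator_mem_center {Q : Type*} [Group Q] {a b : Q}
    (hc : ⁅b, a⁆ ∈ Subgroup.center Q) (hsq : ⁅b, a⁆ ^ 2 = 1) : (a * b) ^ 4 = a ^ 4 * b ^ 4 := by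
  have hz : ∀ x, Commute ⁅b, a⁆ x := fun x => (Subgroup.mem_center_iff.1 hc x).symm
  have hba : b * a = ⁅b, a⁆ * (a * b) := by simp [commutatorElement_def, mul_assoc]
  have hconj : b * a * b⁻¹ = ⁅b, a⁆ * a := by simp [commutatorElement_def, mul_assoc]
  have hcomm : Commute b (a ^ 2) := by
    have h : b * a ^ 2 * b⁻¹ = a ^ 2 := by
      rw [← conj_pow, hconj, (hz a).mul_pow, hsq, one_mul]
    exact mul_inv_eq_iff_eq_mul.1 h
  have hsquare : (a * b) ^ 2 = ⁅b, a⁆ * (a ^ 2 * b ^ 2) := by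
    calc (a * b) ^ 2 = a * (b * a) * b := by simp only [sq, mul_assoc]
      _ = a * ⁅b, a⁆ * (a * b) * b := by rw [hba]; simp only [mul_assoc]
      _ = ⁅b, a⁆ * (a ^ 2 * b ^ 2) := by rw [← (hz a).eq]; simp only [sq, mul_assoc]
  calc (a * b) ^ 4 = ((a * b) ^ 2) ^ 2 := by rw [← pow_mul]
    _ = (a ^ 2 * b ^ 2) ^ 2 := by rw [hsquare, (hz _).mul_pow, hsq, one_mul]
    _ = a ^ 4 * b ^ 4 := by rw [(hcomm.pow_left 2).symm.mul_pow, ← pow_mul, ← pow_mul]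

variable {n : ℕ} {g h : Perm (X n)}

theorem mul_pow_four_mod_FAlt (hg : g ∈ H n) (hh : h ∈ H n) :
    (g ^ 4 * h ^ 4)⁻¹ * (g * h) ^ 4 ∈ FAlt (X n) := by
  have hc := commutator_mem_FSym hh hg
  rw [← QuotientGroup.eq]
  exact (mul_pow_four_of_commutator_mem_center (a := QuotientGroup.mk' (FAlt (X n)) g)
    (b := QuotientGroup.mk' (FAlt (X n)) h) (mk_mem_center_of_mem_FSym hc)
    ((QuotientGroup.eq_one_iff _).2 (sq_mem_FAlt_of_mem_FSym hc))).symm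

theorem FAlt_le_U [NeZero n] (p : ℕ) : FAlt (X n) ≤ U n p :=
  fun _ hf => Subgroup.subset_closure (Or.inl hf)

theorem shift_pow_mem_U [NeZero n] (p : ℕ) {i : Fin n} (hi : 0 ≠ i) : shift 0 i hi ^ p ∈ U n p :=
  Subgroup.subset_closure (Or.inr ⟨i, hi, rfl⟩)

theorem pow_four_mem_U [NeZero n] {p : ℕ} (hg : g ∈ congruenceSubgroup n p) :
    g ^ 4 ∈ U n (4 * p) := by
  let K : Subgroup (Perm (X n)) :=
    { carrier := {g | g ∈ H n ∧ g ^ 4 ∈ U n (4 * p)}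
      one_mem' := ⟨(H n).one_mem, by simp⟩
      mul_mem' := fun ha hb => ⟨(H n).mul_mem ha.1 hb.1,
        (Subgroup.mul_mem_cancel_left _ (Subgroup.inv_mem _ (Subgroup.mul_mem _ ha.2 hb.2))).1
          (FAlt_le_U _ (mul_pow_four_mod_FAlt ha.1 hb.1))⟩
      inv_mem' := fun ha => ⟨(H n).inv_mem ha.1, by
        rw [inv_pow]
        exact Subgroup.inv_mem _ ha.2⟩ }
  have hF : FSym (X n) ≤ K := fun f hf => ⟨FSym_le_H n hf, FAlt_le_U _ (by
    rw [show f ^ 4 = (f ^ 2) ^ 2 from pow_mul f 2 2]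
    exact (FAlt (X n)).pow_mem (sq_mem_FAlt_of_mem_FSym hf) 2)⟩
  have hs : ∀ (i : Fin n) (hi : 0 ≠ i), shift 0 i hi ^ p ∈ K := fun i hi =>
    ⟨(H n).pow_mem (shift_mem_H hi) p, by
      rw [← pow_mul, mul_comm p 4]
      exact shift_pow_mem_U (4 * p) hi⟩
  exact (congruenceSubgroup_le 0 hF hs hg).2

end Commutators

section CommutatorParity

theorem commutator_mul_left_of_mem_center {Q : Type*} [Group Q] {a b c : Q}
    (hb : ⁅b, c⁆ ∈ Subgroup.center Q) : ⁅a * b, c⁆ = ⁅a, c⁆ * ⁅b, c⁆ := by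
  have hz := Subgroup.mem_center_iff.1 hb
  calc ⁅a * b, c⁆ = a * ⁅b, c⁆ * a⁻¹ * ⁅a, c⁆ := by simp only [commutatorElement_def]; group
    _ = ⁅a, c⁆ * ⁅b, c⁆ := by rw [hz a, mul_inv_cancel_right, hz]

theorem commutator_inv_left_of_mem_center {Q : Type*} [Group Q] {a c : Q}
    (ha : ⁅a, c⁆ ∈ Subgroup.center Q) : ⁅a⁻¹, c⁆ = ⁅a, c⁆⁻¹ :=
  eq_inv_of_mul_eq_one_left (by
    rw [← commutator_mul_left_of_mem_center ha, inv_mul_cancel, commutatorElement_one_left])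

variable {n : ℕ} {g h : Perm (X n)} {o : Fin n}

/-- The class of the transpositions in `Sym(X_n) / FAlt(X_n)`, represented by the transposition of
the first two points of the ray `o`. -/
def transpositionClass (o : Fin n) : Perm (X n) ⧸ FAlt (X n) :=
  QuotientGroup.mk (swap (o, 0) (o, 1))

theorem transpositionClass_mem_center (o : Fin n) :
    transpositionClass o ∈ Subgroup.center (Perm (X n) ⧸ FAlt (X n)) :=
  mk_mem_center_of_mem_FSym (swap_mem_FSym (by simp))

theorem transpositionClass_sq (o : Fin n) : transpositionClass o ^ 2 = 1 :=
  (QuotientGroup.eq_one_iff _).2 (sq_mem_FAlt_of_mem_FSym (swap_mem_FSym (by simp)))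

theorem transpositionClass_zpow_of_even (o : Fin n) {k : ℤ} (hk : Even k) :
    transpositionClass o ^ k = 1 := by
  obtain ⟨l, rfl⟩ := hk
  rw [← two_mul, zpow_mul, zpow_ofNat, transpositionClass_sq, one_zpow]

/-- The elements `g` of `H_n` for which the commutator of `g` and `h` is congruent modulo
`FAlt(X_n)` to the power of a transposition with exponent `∑ t_i(g) t_i(h)`. -/
noncomputable def paritySubgroup (o : Fin n) (h : Perm (X n)) : Subgroup (Perm (X n)) where
  carrier := {g | g ∈ H n ∧ ⁅QuotientGroup.mk' (FAlt (X n)) g, QuotientGroup.mk' (FAlt (X n)) h⁆ =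
    transpositionClass o ^ ∑ i, translation g i * translation h i}
  one_mem' := ⟨(H n).one_mem, by simp [translation_one]⟩
  mul_mem' := by
    rintro a b ⟨ha, ha'⟩ ⟨hb, hb'⟩
    have hz := hb' ▸ (Subgroup.center _).zpow_mem (transpositionClass_mem_center o) _
    refine ⟨(H n).mul_mem ha hb, ?_⟩
    simp only [map_mul, translation_mul ha hb, add_mul, Finset.sum_add_distrib, zpow_add]
    rw [commutator_mul_left_of_mem_center hz, ha', hb']
  inv_mem' := by
    rintro a ⟨ha, ha'⟩
    have hz := ha' ▸ (Subgroup.center _).zpow_mem (transpositionClass_mem_center o) _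
    refine ⟨(H n).inv_mem ha, ?_⟩
    simp only [map_inv, translation_inv ha, neg_mul, Finset.sum_neg_distrib, zpow_neg]
    rw [commutator_inv_left_of_mem_center hz, ha']

theorem mem_paritySubgroup_symm (hh : h ∈ H n) (hg : g ∈ paritySubgroup o h) :
    h ∈ paritySubgroup o g := by
  have hinv : (transpositionClass o)⁻¹ = transpositionClass o :=
    inv_eq_of_mul_eq_one_right (by rw [← sq, transpositionClass_sq])
  refine ⟨hh, ?_⟩
  rw [← commutatorElement_inv, hg.2, ← inv_zpow, hinv]
  simp only [mul_comm]

theorem FSym_le_paritySubgroup (o : Fin n) (h : Perm (X n)) :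
    FSym (X n) ≤ paritySubgroup o h := by
  intro f hf
  refine ⟨FSym_le_H n hf, ?_⟩
  simp only [translation_eq_zero_of_mem_FSym hf, zero_mul, Finset.sum_const_zero, zpow_zero]
  rw [← map_commutatorElement]
  exact (QuotientGroup.eq_one_iff _).2 (commutator_mem_FAlt hf h)

theorem shift_mem_paritySubgroup {i j : Fin n} (hi : o ≠ i) (hj : o ≠ j) :
    shift o i hi ∈ paritySubgroup o (shift o j hj) := by
  have hsum : ∑ k, translation (shift o i hi) k * translation (shift o j hj) k =
      1 + if i = j then 1 else 0 := by
    simp [translation_shift, mul_sub, Finset.sum_sub_distrib, hi.symm, hj, eq_comm]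
  refine ⟨shift_mem_H hi, ?_⟩
  rw [hsum, ← map_commutatorElement]
  rcases eq_or_ne i j with rfl | hij
  · rw [commutatorElement_self, map_one, if_pos rfl,
      transpositionClass_zpow_of_even o (by decide)]
  · rw [commutatorElement_def, shift_mul_shift hi hj hij, if_neg hij, add_zero, zpow_one]
    exact congrArg QuotientGroup.mk (by group)

theorem H_le_paritySubgroup (o : Fin n) (hh : h ∈ H n) : H n ≤ paritySubgroup o h :=
  H_le_of_shift_mem o (FSym_le_paritySubgroup o h) fun _ hi =>
    mem_paritySubgroup_symm (shift_mem_H hi)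
      (H_le_of_shift_mem o (FSym_le_paritySubgroup o _)
        (fun _ hj => shift_mem_paritySubgroup hj hi) hh)

theorem commutator_mem_FAlt_of_even (hg : g ∈ H n) (hh : h ∈ H n)
    (heven : Even (∑ i, translation g i * translation h i)) : ⁅g, h⁆ ∈ FAlt (X n) := by
  rcases isEmpty_or_nonempty (Fin n) with _ | ⟨⟨o⟩⟩
  · rw [Subsingleton.elim ⁅g, h⁆ 1]
    exact (FAlt (X n)).one_mem
  · have hmk := (H_le_paritySubgroup o hh hg).2
    rw [transpositionClass_zpow_of_even o heven, ← map_commutatorElement] at hmk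
    exact (QuotientGroup.eq_one_iff _).1 hmk

end CommutatorParity

section NormalizerLowerBounds

variable {n : ℕ} {W : Subgroup (Perm (X n))}

theorem H_le_normalizer (hW : W ≤ H n) (hF : FSym (X n) ≤ W) :
    H n ≤ Subgroup.normalizer (W : Set (Perm (X n))) :=
  Subgroup.le_normalizer_iff_commutator_le_right.2 <| Subgroup.commutator_le.2 fun _ hh _ hw =>
    hF (commutator_mem_FSym hh (hW hw))

theorem le_normalizer_of_even {K : Subgroup (Perm (X n))} (hK : K ≤ H n) (hW : W ≤ H n)
    (hF : FAlt (X n) ≤ W)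
    (heven : ∀ h ∈ K, ∀ w ∈ W, Even (∑ i, translation h i * translation w i)) :
    K ≤ Subgroup.normalizer (W : Set (Perm (X n))) :=
  Subgroup.le_normalizer_iff_commutator_le_right.2 <| Subgroup.commutator_le.2 fun h hh w hw =>
    hF (commutator_mem_FAlt_of_even (hK hh) (hW hw) (heven h hh w hw))

end NormalizerLowerBounds

section Orbits

variable {n : ℕ} {ψ w : Perm (X n)} {k : Fin n}

theorem exists_forall_ge_le_snd {f : ℕ → X n} (hf : Function.Injective f) (z : ℕ) :
    ∃ J, ∀ j, J ≤ j → z ≤ (f j).2 := by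
  have hcofinite : ∀ᶠ j in Filter.cofinite, f j ∉ {x : X n | x.2 < z} :=
    hf.tendsto_cofinite.eventually (finite_setOf_snd_lt z).eventually_cofinite_notMem
  rw [Nat.cofinite_eq_atTop, Filter.eventually_atTop] at hcofinite
  exact hcofinite.imp fun J hJ j hj => not_lt.1 (hJ j hj)

theorem exists_progression_of_orbit (hw : w ∈ H n) {f : ℕ → X n} (hf : Function.Injective f)
    (hfw : ∀ j, f (j + 1) = w (f j)) :
    ∃ k c s J, 0 < s ∧ ∀ j, f (J + j) = (k, c + s * j) := by
  obtain ⟨z, hz⟩ := exists_forall_ge_apply hw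
  obtain ⟨J, hJ⟩ := exists_forall_ge_le_snd hf z
  set k := (f J).1 with hk
  set c := (f J).2 with hc
  have hstep : ∀ j : ℕ,
      (f (J + j)).1 = k ∧ ((f (J + j)).2 : ℤ) = c + translation w k * j := by
    intro j
    induction j with
    | zero => simp [hk, hc]
    | succ j ih =>
      obtain ⟨h₁, h₂⟩ := hz (f (J + j)).1 (f (J + j)).2 (hJ _ (by omega))
      rw [Prod.mk.eta, ← hfw, ih.1] at h₁ h₂
      refine ⟨h₁, ?_⟩
      rw [← add_assoc, h₂, ih.2]
      push_cast
      ring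
  have hpos : 0 < translation w k := by
    rcases lt_trichotomy 0 (translation w k) with h | h | h
    · exact h
    · have h₁ := hstep 1
      rw [← h, zero_mul, add_zero] at h₁
      have := hf (Prod.ext h₁.1 (by exact_mod_cast h₁.2) : f (J + 1) = f J)
      omega
    · have h₁ := (hstep (c + 1)).2
      push_cast at h₁
      nlinarith
  refine ⟨k, c, (translation w k).toNat, J, by omega, fun j => Prod.ext (hstep j).1 ?_⟩
  zify
  rw [(hstep j).2, Int.toNat_of_nonneg hpos.le]

theorem exists_progression_of_conj_mem_H (hw : EventualTranslation w k 1)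
    (hψ : ψ * w * ψ⁻¹ ∈ H n) : ∃ l c s M, 0 < s ∧ ∀ j, ψ (k, M + j) = (l, c + s * j) := by
  obtain ⟨z, hz⟩ := hw
  have hsucc : ∀ j, w (k, z + j) = (k, z + (j + 1)) := by
    intro j
    obtain ⟨h₁, h₂⟩ := hz (z + j) (by omega)
    exact Prod.ext h₁ (by zify; rw [h₂]; push_cast; ring)
  obtain ⟨l, c, s, J, hs, h⟩ := exists_progression_of_orbit hψ (f := fun j => ψ (k, z + j))
    (fun a b hab => by simpa using ψ.injective hab) (fun j => by simp [hsucc])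
  exact ⟨l, c, s, z + J, hs, fun j => by rw [add_assoc, h]⟩

theorem progression_step_eq_one {l k' : Fin n} {c s M c' s' M' : ℕ}
    (hψ : ∀ j, ψ (k, M + j) = (l, c + s * j)) (hs : 0 < s)
    (hψ' : ∀ j, ψ⁻¹ (l, M' + j) = (k', c' + s' * j)) : s = 1 := by
  have hle : M' ≤ s * M' := Nat.le_mul_of_pos_left M' hs
  obtain ⟨A, hA⟩ : ∃ A, c + s * M' = M' + A := ⟨c + s * M' - M', by omega⟩
  have hinv : ∀ i j, c + s * i = M' + j → c' + s' * j = M + i := by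
    intro i j hij
    have h := hψ' j
    rw [← hij, ← hψ i, Perm.inv_def, Equiv.symm_apply_apply] at h
    exact (congrArg Prod.snd h).symm
  have h₀ := hinv M' A hA
  have h₁ := hinv (M' + 1) (A + s) (by rw [mul_add, ← add_assoc, hA]; ring)
  rw [mul_add] at h₁
  exact Nat.eq_one_of_mul_eq_one_left (by omega : s' * s = 1)

theorem exists_eq_rayPerm_mul (hψ : ∀ k, ∃ l c M, ∀ j, ψ (k, M + j) = (l, c + j)) :
    ∃ π, ∃ h ∈ H n, ψ = rayPerm n π * h := by
  choose π c M hπ using hψ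
  have hinj : Function.Injective π := by
    intro k l hkl
    have hcollide : ψ (k, M k + c l) = ψ (l, M l + c k) := by
      rw [hπ, hπ, hkl, add_comm]
    exact congrArg Prod.fst (ψ.injective hcollide)
  let σ : Perm (Fin n) := Equiv.ofBijective π (Finite.injective_iff_bijective.1 hinj)
  refine ⟨σ, (rayPerm n σ)⁻¹ * ψ, fun k => ⟨c k - M k, M k, fun m hm => ?_⟩,
    (mul_inv_cancel_left _ _).symm⟩
  obtain ⟨j, rfl⟩ := Nat.exists_eq_add_of_le hm
  have hray : ((rayPerm n σ)⁻¹ * ψ) (k, M k + j) = (k, c k + j) := by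
    rw [Perm.mul_apply, Perm.inv_eq_iff_eq, hπ]
    rfl
  rw [hray]
  exact ⟨rfl, by push_cast; ring⟩

end Orbits

section NormalizerUpperBounds

variable {n : ℕ} {W : Subgroup (Perm (X n))} {ν : Perm (X n)}

theorem exists_eq_rayPerm_mul_of_mem_normalizer (hW : W ≤ H n)
    (hunit : ∀ k, ∃ w ∈ W, EventualTranslation w k 1)
    (hν : ν ∈ Subgroup.normalizer (W : Set (Perm (X n)))) :
    ∃ π, ∃ h ∈ H n, ν = rayPerm n π * h := by
  have hprog : ∀ μ ∈ Subgroup.normalizer (W : Set (Perm (X n))), ∀ k,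
      ∃ l c s M, 0 < s ∧ ∀ j, μ (k, M + j) = (l, c + s * j) := by
    intro μ hμ k
    obtain ⟨w, hwW, hw⟩ := hunit k
    exact exists_progression_of_conj_mem_H hw (hW ((Subgroup.mem_normalizer_iff.1 hμ w).1 hwW))
  refine exists_eq_rayPerm_mul fun k => ?_
  obtain ⟨l, c, s, M, hs, h⟩ := hprog ν hν k
  obtain ⟨_, _, _, _, -, h'⟩ := hprog ν⁻¹ (inv_mem hν) l
  obtain rfl := progression_step_eq_one h hs h'
  exact ⟨l, c, M, fun j => by rw [h, one_mul]⟩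

theorem normalizer_le_HS (hW : W ≤ H n) (hunit : ∀ k, ∃ w ∈ W, EventualTranslation w k 1) :
    Subgroup.normalizer (W : Set (Perm (X n))) ≤ HS n := by
  intro ν hν
  obtain ⟨π, h, hh, rfl⟩ := exists_eq_rayPerm_mul_of_mem_normalizer hW hunit hν
  exact (HS n).mul_mem (Subgroup.mem_sup_right ⟨π, rfl⟩) (Subgroup.mem_sup_left hh)

theorem EventualTranslation.rayPerm_conj {g : Perm (X n)} {k : Fin n} {t : ℤ}
    (hg : EventualTranslation g k t) (π : Perm (Fin n)) :
    EventualTranslation (rayPerm n π * g * (rayPerm n π)⁻¹) (π k) t := by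
  obtain ⟨z, hz⟩ := hg
  refine ⟨z, fun m hm => ?_⟩
  have hconj : (rayPerm n π * g * (rayPerm n π)⁻¹) (π k, m) = rayPerm n π (g (k, m)) := by
    have hinv : (rayPerm n π)⁻¹ (π k, m) = (k, m) := Perm.inv_eq_iff_eq.2 rfl
    simp only [Perm.mul_apply, hinv]
  obtain ⟨h₁, h₂⟩ := hz m hm
  rw [hconj]
  exact ⟨congrArg π h₁, h₂⟩

theorem translation_conj_rayPerm_mul {h w : Perm (X n)} (hh : h ∈ H n) (hw : w ∈ H n)
    (π : Perm (Fin n)) (k : Fin n) :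
    translation (rayPerm n π * h * w * (rayPerm n π * h)⁻¹) (π k) = translation w k := by
  have hh' := eventualTranslation_translation hh k
  have hconj := ((hh'.mul (eventualTranslation_translation hw k)).mul hh'.inv).rayPerm_conj π
  rw [add_neg_cancel_comm] at hconj
  simpa only [mul_inv_rev, mul_assoc] using hconj.translation_eq

theorem exists_forall_translation_conj_eq (hW : W ≤ H n)
    (hunit : ∀ k, ∃ w ∈ W, EventualTranslation w k 1)
    (hν : ν ∈ Subgroup.normalizer (W : Set (Perm (X n)))) :
    ∃ π : Perm (Fin n), ∀ w ∈ W, ∀ k, translation (ν * w * ν⁻¹) (π k) = translation w k := by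
  obtain ⟨π, h, hh, rfl⟩ := exists_eq_rayPerm_mul_of_mem_normalizer hW hunit hν
  exact ⟨π, fun w hw k => translation_conj_rayPerm_mul hh (hW hw) π k⟩

end NormalizerUpperBounds

section TranslationLengths

variable {n : ℕ} {V : Subgroup (Perm (X n))} {i : Fin n}

theorem exists_forall_shift_pow_mem (hV : (V.subgroupOf (H n)).FiniteIndex) :
    ∃ p : ℕ, 0 < p ∧ ∀ (a b : Fin n) (hab : a ≠ b), shift a b hab ^ p ∈ V :=
  ⟨_, Nat.factorial_pos _, fun _ _ hab => Subgroup.pow_mem_of_index_ne_zero_of_dvd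
    hV.index_ne_zero (⟨_, shift_mem_H hab⟩ : H n) fun _ h h' => Nat.dvd_factorial h h'⟩

theorem translation_shift_pow {a b : Fin n} (hab : a ≠ b) (p : ℕ) (i : Fin n) :
    translation (shift a b hab ^ p) i =
      p * ((if i = a then 1 else 0) - if i = b then 1 else 0) := by
  rw [translation_pow (shift_mem_H hab), translation_shift]

theorem T_pos (hn : 2 ≤ n) {p : ℕ} (hp : 0 < p)
    (hs : ∀ (a b : Fin n) (hab : a ≠ b), shift a b hab ^ p ∈ V) (i : Fin n) : 0 < T V i := by
  have : Nontrivial (Fin n) := Fin.nontrivial_iff_two_le.2 hn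
  obtain ⟨j, hj⟩ := exists_ne i
  have hshift := eventualTranslation_translation
    ((H n).pow_mem (shift_mem_H hj.symm) p) i
  rw [translation_shift_pow, if_pos rfl, if_neg hj.symm, sub_zero, mul_one] at hshift
  exact (Nat.sInf_mem (s := {k : ℕ | 0 < k ∧ ∃ u ∈ V, EventualTranslation u i k})
    ⟨p, hp, _, hs i j hj.symm, hshift⟩).1

theorem exists_eventualTranslation_T (hT : 0 < T V i) :
    ∃ u ∈ V, EventualTranslation u i (T V i) :=
  (Nat.sInf_mem (Nat.nonempty_of_pos_sInf hT)).2

theorem T_dvd_translation (hV : V ≤ H n) (hT : 0 < T V i) {u : Perm (X n)} (hu : u ∈ V) :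
    (T V i : ℤ) ∣ translation u i := by
  obtain ⟨v, hv, hvT⟩ := exists_eventualTranslation_T hT
  by_contra hdvd
  have hT' : (0 : ℤ) < T V i := by exact_mod_cast hT
  have hmem : u * v ^ (-(translation u i / T V i)) ∈ V := V.mul_mem hu (V.zpow_mem hv _)
  have hrem : translation (u * v ^ (-(translation u i / T V i))) i =
      translation u i % T V i := by
    rw [translation_mul (hV hu) ((H n).zpow_mem (hV hv) _), translation_zpow (hV hv),
      hvT.translation_eq, Int.emod_def]
    ring
  have hrem_pos : 0 < translation u i % T V i :=
    (Int.emod_nonneg _ hT'.ne').lt_of_ne fun h => hdvd (Int.dvd_of_emod_eq_zero h.symm)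
  have hrem_lt := Int.emod_lt_of_pos (translation u i) hT'
  have hle : T V i ≤ (translation u i % T V i).toNat :=
    Nat.sInf_le ⟨by omega, _, hmem, by
      rw [Int.toNat_of_nonneg hrem_pos.le, ← hrem]
      exact eventualTranslation_translation (hV hmem) i⟩
  omega

end TranslationLengths

section PermCongr

variable {α β : Type*} (e : α ≃ β) {V : Subgroup (Perm α)}

theorem FSym_le_map_permCongrHom (hV : FSym α ≤ V) :
    FSym β ≤ V.map e.permCongrHom.toMonoidHom := by
  intro f hf
  refine ⟨e.permCongrHom.symm f, hV ?_, e.permCongrHom.apply_symm_apply f⟩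
  refine (hf.image e.symm).subset fun x hx => ⟨e x, fun h => hx ?_, e.symm_apply_apply x⟩
  simp [Equiv.permCongr_apply, h]

theorem FAlt_le_map_permCongrHom (hV : FAlt α ≤ V) :
    FAlt β ≤ V.map e.permCongrHom.toMonoidHom := by
  classical
  refine FAlt_le_of_swap_mul_swap_mem fun a b c d hab hcd =>
    ⟨swap (e.symm a) (e.symm b) * swap (e.symm c) (e.symm d), hV <|
      swap_mul_swap_mem_FAlt (e.symm.injective.ne hab) (e.symm.injective.ne hcd), ?_⟩
  have hswap (x y : β) : e.permCongrHom (swap (e.symm x) (e.symm y)) = swap x y := by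
    rw [Equiv.permCongrHom_coe, Equiv.permCongr_def, Equiv.symm_trans_swap_trans,
      e.apply_symm_apply, e.apply_symm_apply]
  exact (map_mul e.permCongrHom _ _).trans (by rw [hswap, hswap])

end PermCongr

section RefineRays

variable {n : ℕ} {r : Fin n → ℕ} {hr : ∀ i, 0 < r i}

theorem refineRays_apply (i : Fin n) (d : Fin (r i)) (k : ℕ) :
    refineRays r hr (i, d + r i * k) = (finSigmaFinEquiv ⟨i, d⟩, k) := by
  rw [← Equiv.eq_symm_apply]
  simp [refineRays, splitRays]

theorem EventualTranslation.refineRays_permCongr {u : Perm (X n)} {i : Fin n} {q : ℤ}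
    (hu : EventualTranslation u i (r i * q)) (d : Fin (r i)) :
    EventualTranslation ((refineRays r hr).permCongrHom u) (finSigmaFinEquiv ⟨i, d⟩) q := by
  obtain ⟨z, hz⟩ := hu
  refine ⟨z + q.natAbs, fun m hm => ?_⟩
  have hle : m ≤ r i * m := Nat.le_mul_of_pos_left m (hr i)
  obtain ⟨h₁, h₂⟩ := hz (d + r i * m) (by omega)
  have hu_apply : u (i, d + r i * m) = (i, d + r i * (m + q).toNat) := by
    refine Prod.ext h₁ ?_
    zify
    rw [h₂, Int.toNat_of_nonneg (by omega)]
    push_cast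
    ring
  have hrefine : (refineRays r hr).permCongrHom u (finSigmaFinEquiv ⟨i, d⟩, m) =
      (finSigmaFinEquiv ⟨i, d⟩, (m + q).toNat) := by
    rw [Equiv.permCongrHom_coe, Equiv.permCongr_apply, ← refineRays_apply (hr := hr) i d m,
      Equiv.symm_apply_apply, hu_apply, refineRays_apply]
  rw [hrefine]
  exact ⟨rfl, Int.toNat_of_nonneg (by omega)⟩

end RefineRays

section Refinement

variable {n : ℕ} {V : Subgroup (Perm (X n))}

/-- The image of `V` under the isomorphism `φ̂ : Sym(X_n) ≃ Sym(X_T)`, which cuts the `i`-th ray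
into `T V i` rays. -/
noncomputable def refinement (V : Subgroup (Perm (X n))) (hT : ∀ i, 0 < T V i) :
    Subgroup (Perm (X (∑ i, T V i))) :=
  V.map (refineRays (T V) hT).permCongrHom.toMonoidHom

/-- The ray of `X_n` out of which the `k`-th ray of `X_T` is cut. -/
def parentRay {r : Fin n → ℕ} (k : Fin (∑ i, r i)) : Fin n :=
  (finSigmaFinEquiv.symm k).1

theorem parentRay_finSigmaFinEquiv {r : Fin n → ℕ} (x : Σ i, Fin (r i)) :
    parentRay (finSigmaFinEquiv x) = x.1 := by
  rw [parentRay, Equiv.symm_apply_apply]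

theorem card_filter_parentRay_eq (r : Fin n → ℕ) (i : Fin n) :
    (Finset.univ.filter fun k : Fin (∑ i, r i) => parentRay k = i).card = r i := by
  have hfiber : (Finset.univ.filter fun k : Fin (∑ i, r i) => parentRay k = i) =
      Finset.univ.map ((Function.Embedding.sigmaMk i).trans finSigmaFinEquiv.toEmbedding) := by
    ext k
    obtain ⟨⟨j, d⟩, rfl⟩ := finSigmaFinEquiv.surjective k
    simp only [Finset.mem_filter, Finset.mem_univ, true_and, parentRay_finSigmaFinEquiv,
      Finset.mem_map, Function.Embedding.trans_apply, Function.Embedding.sigmaMk_apply,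
      Equiv.coe_toEmbedding, EmbeddingLike.apply_eq_iff_eq]
    constructor
    · rintro rfl
      exact ⟨d, rfl⟩
    · rintro ⟨_, h⟩
      exact (congrArg Sigma.fst h).symm
  rw [hfiber, Finset.card_map, Finset.card_univ, Fintype.card_fin]

variable {hT : ∀ i, 0 < T V i}

theorem refinedNormalizer_eq : refinedNormalizer V hT =
    Subgroup.normalizer (refinement V hT : Set (Perm (X (∑ i, T V i)))) :=
  Subgroup.map_equiv_normalizer_eq V _

theorem mem_refinement {u : Perm (X n)} (hu : u ∈ V) :
    (refineRays (T V) hT).permCongrHom u ∈ refinement V hT :=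
  Subgroup.mem_map_of_mem _ hu

theorem exists_mem_refinement_eventualTranslation_one (k : Fin (∑ i, T V i)) :
    ∃ w ∈ refinement V hT, EventualTranslation w k 1 := by
  obtain ⟨⟨i, d⟩, rfl⟩ := finSigmaFinEquiv.surjective k
  obtain ⟨u, hu, hui⟩ := exists_eventualTranslation_T (hT i)
  exact ⟨_, mem_refinement hu, EventualTranslation.refineRays_permCongr (by rwa [mul_one]) d⟩

theorem eventualTranslation_refinement (hV : V ≤ H n) {u : Perm (X n)} (hu : u ∈ V)
    (k : Fin (∑ i, T V i)) :
    EventualTranslation ((refineRays (T V) hT).permCongrHom u) k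
      (translation u (parentRay k) / T V (parentRay k)) := by
  obtain ⟨⟨i, d⟩, rfl⟩ := finSigmaFinEquiv.surjective k
  rw [parentRay_finSigmaFinEquiv]
  refine EventualTranslation.refineRays_permCongr ?_ d
  rw [Int.mul_ediv_cancel' (T_dvd_translation hV (hT i) hu)]
  exact eventualTranslation_translation (hV hu) i

theorem refinement_le_H (hV : V ≤ H n) : refinement V hT ≤ H (∑ i, T V i) := by
  rintro _ ⟨u, hu, rfl⟩ k
  exact ⟨_, eventualTranslation_refinement hV hu k⟩

theorem T_mul_translation_refinement (hV : V ≤ H n) {u : Perm (X n)} (hu : u ∈ V)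
    (k : Fin (∑ i, T V i)) :
    T V (parentRay k) * translation ((refineRays (T V) hT).permCongrHom u) k =
      translation u (parentRay k) := by
  rw [(eventualTranslation_refinement hV hu k).translation_eq,
    Int.mul_ediv_cancel' (T_dvd_translation hV (hT _) hu)]

end Refinement

section Conjugation

variable {n p : ℕ} {V : Subgroup (Perm (X n))} {hT : ∀ i, 0 < T V i} {ν : Perm (X n)}

theorem parentRay_eq_iff (hV : V ≤ H n) (hp : 0 < p)
    (hs : ∀ (a b : Fin n) (hab : a ≠ b), shift a b hab ^ p ∈ V) (k l : Fin (∑ i, T V i)) :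
    parentRay k = parentRay l ↔ ∀ w ∈ refinement V hT, translation w k = translation w l := by
  have hT' (i : Fin n) : (0 : ℤ) < T V i := by exact_mod_cast hT i
  constructor
  · rintro hkl _ ⟨u, hu, rfl⟩
    refine mul_left_cancel₀ (hT' (parentRay k)).ne' ?_
    refine (T_mul_translation_refinement hV hu k).trans ?_
    rw [hkl]
    exact (T_mul_translation_refinement hV hu l).symm
  · intro h
    by_contra hkl
    have hk := T_mul_translation_refinement (hT := hT) hV (hs _ _ hkl) k
    have hl := T_mul_translation_refinement (hT := hT) hV (hs _ _ hkl) l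
    rw [h _ (mem_refinement (hs _ _ hkl)), translation_shift_pow] at hk
    rw [translation_shift_pow] at hl
    simp only [if_true, if_neg hkl, if_neg (Ne.symm hkl), sub_zero, zero_sub, mul_one] at hk hl
    have hp' : (0 : ℤ) < p := by exact_mod_cast hp
    have hpos := pos_of_mul_pos_right (hk ▸ hp') (hT' (parentRay k)).le
    nlinarith [mul_pos (hT' (parentRay l)) hpos]

theorem T_parentRay_eq_of_forall_iff (π : Perm (Fin (∑ i, T V i)))
    (hπ : ∀ k l, parentRay (π k) = parentRay (π l) ↔ parentRay k = parentRay l)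
    (k : Fin (∑ i, T V i)) : T V (parentRay (π k)) = T V (parentRay k) := by
  rw [← card_filter_parentRay_eq (T V) (parentRay (π k)),
    ← card_filter_parentRay_eq (T V) (parentRay k)]
  refine (Finset.card_bijective π π.bijective fun l => ?_).symm
  simp only [Finset.mem_filter, Finset.mem_univ, true_and, hπ]

theorem forall_translation_conj_eq_iff {W : Subgroup (Perm (X n))}
    (hν : ν ∈ Subgroup.normalizer (W : Set (Perm (X n)))) {π : Perm (Fin n)}
    (hπ : ∀ w ∈ W, ∀ k, translation (ν * w * ν⁻¹) (π k) = translation w k) (k l : Fin n) :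
    (∀ w ∈ W, translation w (π k) = translation w (π l)) ↔
      ∀ w ∈ W, translation w k = translation w l := by
  constructor <;> intro h w hw
  · rw [← hπ w hw k, ← hπ w hw l, h _ ((Subgroup.mem_normalizer_iff.1 hν w).1 hw)]
  · have hconj := (Subgroup.mem_normalizer_iff''.1 hν w).1 hw
    have hw_eq : w = ν * (ν⁻¹ * w * ν) * ν⁻¹ := by group
    rw [hw_eq, hπ _ hconj, hπ _ hconj, h _ hconj]

theorem exists_forall_translation_conj_eq_of_mem_normalizer (hV : V ≤ H n) (hT : ∀ i, 0 < T V i)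
    (hp : 0 < p) (hs : ∀ (a b : Fin n) (hab : a ≠ b), shift a b hab ^ p ∈ V)
    (hν : ν ∈ Subgroup.normalizer (V : Set (Perm (X n)))) (j : Fin n) :
    ∃ i, ∀ u ∈ V, translation (ν * u * ν⁻¹) j = translation u i := by
  have hν' : (refineRays (T V) hT).permCongrHom ν ∈
      Subgroup.normalizer (refinement V hT : Set (Perm (X (∑ i, T V i)))) := by
    rw [← refinedNormalizer_eq]
    exact Subgroup.mem_map_of_mem _ hν
  obtain ⟨π, hπ⟩ := exists_forall_translation_conj_eq (refinement_le_H hV)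
    exists_mem_refinement_eventualTranslation_one hν'
  have hparent : ∀ k l, parentRay (π k) = parentRay (π l) ↔ parentRay k = parentRay l := by
    intro k l
    rw [parentRay_eq_iff hV hp hs, parentRay_eq_iff hV hp hs]
    exact forall_translation_conj_eq_iff hν' hπ k l
  obtain ⟨k, hk⟩ := π.surjective (finSigmaFinEquiv ⟨j, 0, hT j⟩)
  have hkj : parentRay (π k) = j := by rw [hk, parentRay_finSigmaFinEquiv]
  refine ⟨parentRay k, fun u hu => ?_⟩
  rw [← T_mul_translation_refinement hV hu k (hT := hT),
    ← T_parentRay_eq_of_forall_iff π hparent, ← hπ _ (mem_refinement hu) k, ← map_inv, ← map_mul,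
    ← map_mul, T_mul_translation_refinement hV ((Subgroup.mem_normalizer_iff.1 hν u).1 hu), hkj]

theorem conj_mem_congruenceSubgroup (hV : V ≤ H n) (hT : ∀ i, 0 < T V i) (hp : 0 < p)
    (hs : ∀ (a b : Fin n) (hab : a ≠ b), shift a b hab ^ p ∈ V)
    (hν : ν ∈ Subgroup.normalizer (V : Set (Perm (X n)))) {u : Perm (X n)} (hu : u ∈ V)
    (hup : u ∈ congruenceSubgroup n p) : ν * u * ν⁻¹ ∈ congruenceSubgroup n p := by
  refine ⟨hV ((Subgroup.mem_normalizer_iff.1 hν u).1 hu), fun j => ?_⟩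
  obtain ⟨i, hi⟩ := exists_forall_translation_conj_eq_of_mem_normalizer hV hT hp hs hν j
  rw [hi u hu]
  exact hup.2 i

variable [NeZero n]

theorem U_le (hF : FAlt (X n) ≤ V)
    (hs : ∀ (i : Fin n) (hi : 0 ≠ i), shift 0 i hi ^ p ∈ V) : U n p ≤ V := by
  refine (Subgroup.closure_le _).2 (Set.union_subset hF ?_)
  rintro _ ⟨i, hi, rfl⟩
  exact hs i hi

theorem normalizer_le_normalizer_U (hV : V ≤ H n) (hT : ∀ i, 0 < T V i) (hp : 0 < p)
    (hs : ∀ (a b : Fin n) (hab : a ≠ b), shift a b hab ^ p ∈ V) :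
    Subgroup.normalizer (V : Set (Perm (X n))) ≤
      Subgroup.normalizer (U n (4 * p) : Set (Perm (X n))) := by
  refine Subgroup.le_normalizer_closure_iff.2 ?_
  rintro ν hν _ (hf | ⟨i, hi, rfl⟩)
  · exact FAlt_le_U _ ((FAlt_normal (X n)).conj_mem _ hf ν)
  · have hmem : shift 0 i hi ^ p ∈ congruenceSubgroup n p :=
      ⟨hV (hs 0 i hi), fun j => ⟨_, translation_shift_pow hi p j⟩⟩
    have hpow := pow_four_mem_U (conj_mem_congruenceSubgroup hV hT hp hs hν (hs 0 i hi) hmem)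
    rwa [conj_pow, ← pow_mul, mul_comm p] at hpow

end Conjugation

section RefinedNormalizer

variable {n : ℕ} {V : Subgroup (Perm (X n))} {hT : ∀ i, 0 < T V i}

theorem refinedNormalizer_le_HS (hV : V ≤ H n) : refinedNormalizer V hT ≤ HS (∑ i, T V i) := by
  rw [refinedNormalizer_eq]
  exact normalizer_le_HS (refinement_le_H hV) exists_mem_refinement_eventualTranslation_one

theorem H_le_refinedNormalizer_of_FSym_le (hV : V ≤ H n) (hF : FSym (X n) ≤ V) :
    H (∑ i, T V i) ≤ refinedNormalizer V hT := by
  rw [refinedNormalizer_eq]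
  exact H_le_normalizer (refinement_le_H hV) (FSym_le_map_permCongrHom _ hF)

theorem congruenceSubgroup_two_le_refinedNormalizer (hV : V ≤ H n) (hF : FAlt (X n) ≤ V) :
    congruenceSubgroup (∑ i, T V i) 2 ≤ refinedNormalizer V hT := by
  rw [refinedNormalizer_eq]
  exact le_normalizer_of_even (fun _ hh => hh.1) (refinement_le_H hV)
    (FAlt_le_map_permCongrHom _ hF) fun _ hh _ _ =>
      Finset.even_sum _ fun k _ => (even_iff_two_dvd.2 (hh.2 k)).mul_right _

end RefinedNormalizer

section TwoRays

variable {V : Subgroup (Perm (X 2))} {hT : ∀ i, 0 < T V i}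

theorem translation_ray_one_eq_neg {u : Perm (X 2)} (hu : u ∈ H 2) :
    translation u 1 = -translation u 0 := by
  have hsum := sum_translation_eq_zero hu
  rw [Fin.sum_univ_two] at hsum
  omega

theorem T_one_eq_T_zero (hV : V ≤ H 2) (hT : ∀ i, 0 < T V i) : T V 1 = T V 0 := by
  obtain ⟨u, hu, hu₀⟩ := exists_eventualTranslation_T (hT 0)
  obtain ⟨v, hv, hv₁⟩ := exists_eventualTranslation_T (hT 1)
  have hu' := translation_ray_one_eq_neg (hV hu)
  have hv' := translation_ray_one_eq_neg (hV hv)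
  have h₁ := T_dvd_translation hV (hT 1) hu
  have h₀ := T_dvd_translation hV (hT 0) hv
  rw [hu', hu₀.translation_eq, dvd_neg, Int.natCast_dvd_natCast] at h₁
  rw [← neg_eq_iff_eq_neg.2 hv', hv₁.translation_eq, dvd_neg, Int.natCast_dvd_natCast] at h₀
  exact Nat.dvd_antisymm h₁ h₀

theorem exists_translation_refinement_eq_or_eq_neg (hV : V ≤ H 2)
    {w : Perm (X (∑ i, T V i))} (hw : w ∈ refinement V hT) :
    ∃ a, ∀ k, translation w k = a ∨ translation w k = -a := by
  obtain ⟨u, hu, rfl⟩ := hw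
  refine ⟨translation u 0 / T V 0, fun k => ?_⟩
  have hk := (eventualTranslation_refinement (hT := hT) hV hu k).translation_eq
  obtain h | h : parentRay k = 0 ∨ parentRay k = 1 := by omega
  · exact Or.inl (by rwa [h] at hk)
  · rw [h, T_one_eq_T_zero hV hT, translation_ray_one_eq_neg (hV hu),
      Int.neg_ediv_of_dvd (T_dvd_translation hV (hT 0) hu)] at hk
    exact Or.inr hk

theorem even_sum_mul_translation {n : ℕ} {h : Perm (X n)} (hh : h ∈ H n) {t : Fin n → ℤ} {a : ℤ}
    (ht : ∀ k, t k = a ∨ t k = -a) : Even (∑ k, translation h k * t k) := by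
  have hsub : ∑ k, translation h k * t k = ∑ k, translation h k * (t k - a) := by
    simp only [mul_sub, Finset.sum_sub_distrib, ← Finset.sum_mul, sum_translation_eq_zero hh,
      zero_mul, sub_zero]
  rw [hsub]
  refine Finset.even_sum _ fun k _ => Even.mul_left ?_ _
  rcases ht k with hk | hk <;> rw [hk]
  · simp
  · exact ⟨-a, by ring⟩

theorem H_le_refinedNormalizer_of_FAlt_le (hV : V ≤ H 2) (hF : FAlt (X 2) ≤ V) :
    H (∑ i, T V i) ≤ refinedNormalizer V hT := by
  rw [refinedNormalizer_eq]
  refine le_normalizer_of_even le_rfl (refinement_le_H hV) (FAlt_le_map_permCongrHom _ hF)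
    fun h hh w hw => ?_
  obtain ⟨a, ha⟩ := exists_translation_refinement_eq_or_eq_neg hV hw
  exact even_sum_mul_translation hh ha

end TwoRays

end Houghton

theorem mainTheorem6 (n : ℕ) [NeZero n] (hn : 2 ≤ n)
    (V : Subgroup (Equiv.Perm (Houghton.X n))) (hV : V ≤ Houghton.H n)
    (hfin : (V.subgroupOf (Houghton.H n)).FiniteIndex) :
    (∃ m : ℕ, 0 < m ∧ Houghton.U n m ≤ V ∧
      Subgroup.normalizer (V : Set (Equiv.Perm (Houghton.X n))) ≤
        Subgroup.normalizer (Houghton.U n m : Set (Equiv.Perm (Houghton.X n))) ∧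
      ((Houghton.U n m).subgroupOf V).Characteristic) ∧
    ∃ hT : ∀ i, 0 < Houghton.T V i,
      Houghton.refinedNormalizer V hT ≤ Houghton.HS (∑ i, Houghton.T V i) ∧
      ((n = 2 ∨ Houghton.FSym (Houghton.X n) ≤ V) →
        Houghton.H (∑ i, Houghton.T V i) ≤ Houghton.refinedNormalizer V hT) ∧
      (∀ h ∈ Houghton.H (∑ i, Houghton.T V i),
        (∀ k t, Houghton.EventualTranslation h k t → Even t) →
          h ∈ Houghton.refinedNormalizer V hT) := by
  have hF := Houghton.FAlt_le_of_finiteIndex (Houghton.FSym_le_H n) hfin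
  obtain ⟨p, hp, hs⟩ := Houghton.exists_forall_shift_pow_mem hfin
  have hT := Houghton.T_pos hn hp hs
  have hnorm := Houghton.normalizer_le_normalizer_U hV hT hp hs
  refine ⟨⟨4 * p, by omega, ?_, hnorm,
    Houghton.characteristic_subgroupOf_of_normalizer_le hF hnorm⟩, hT,
    Houghton.refinedNormalizer_le_HS hV, ?_, fun h hh heven => ?_⟩
  · refine Houghton.U_le hF fun i hi => ?_
    rw [mul_comm, pow_mul]
    exact V.pow_mem (hs 0 i hi) 4
  · rintro (rfl | hFSym)
    · exact Houghton.H_le_refinedNormalizer_of_FAlt_le hV hF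
    · exact Houghton.H_le_refinedNormalizer_of_FSym_le hV hFSym
  · exact Houghton.congruenceSubgroup_two_le_refinedNormalizer hV hF
      ⟨hh, fun k => (heven k _ (Houghton.eventualTranslation_translation hh k)).two_dvd⟩
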